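/- Let $\Gamma\subset \mathrm{SL}_2(\mathbb R)$ be a Fuchsian group of the first kind (a discrete subgroup such that $\Gamma\backslash\mathbb H$ has finite hyperbolic area) and let $k\ge 4$ be an even integer. Write $j(g,z)=cz+d$ and $(f|_kg)(z)=j(g,z)^{-k}f(gz)$ for $g=\begin{pmatrix}a&b\\c&d\end{pmatrix}\in \mathrm{SL}_2(\mathbb R)$, and $\mathbf e(x)=e^{2\pi i x}$; complex powers and logarithms are principal ($-\pi<\arg\le\pi$). Let $\mathfrak a\in\mathbb R\cup\{\infty\}$ be a cusp of $\Gamma$ (a point fixed by a parabolic element of $\Gamma$), with stabilizer $\Gamma_{\mathfrak a}$ and scaling matrix $\sigma_{\mathfrak a}\in \mathrm{SL}_2(\mathbb R)$: $\sigma_{\mathfrak a}\infty=\mathfrak a$ and, up to signs, $\sigma_{\mathfrak a}^{-1}\Gamma_{\mathfrak a}\sigma_{\mathfrak a}$ is $\{\begin{pmatrix}1&t\\0&1\end{pmatrix}: t\in\mathbb Z\}$. Let $\eta=(\eta_1,\eta_2)$ be a pair of distinct points of $\mathbb R\cup\{\infty\}$ both fixed by one hyperbolic element of $\Gamma$, let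 $\Gamma_\eta$ be the subgroup of $\Gamma$ fixing both, and let $\sigma_\eta\in \mathrm{SL}_2(\mathbb R)$ and $\ell_\eta>0$ satisfy $\sigma_\eta 0=\eta_1$, $\sigma_\eta\infty=\eta_2$ and, up to signs, $\sigma_\eta^{-1}\Gamma_\eta\sigma_\eta=\{\begin{pmatrix}e^{t\ell_\eta/2}&0\\0&e^{-t\ell_\eta/2}\end{pmatrix}: t\in\mathbb Z\}$. For $m\in\mathbb Z$ the hyperbolic Poincaré series $$P_{\eta,m}(z)=\sum_{\gamma\in\Gamma_\eta\backslash\Gamma}\frac{(\sigma_\eta^{-1}\gamma z)^{-k/2+2\pi i m/\ell_\eta}}{j(\sigma_\eta^{-1}\gamma,z)^k}\qquad(z\in\mathbb H)$$ converges absolutely, and it has a Fourier expansion at $\mathfrak a$, $(P_{\eta,m}|_k\sigma_{\mathfrak a})(z)=\sum_{n\in\mathbb Z}c_{\mathfrak a}(n;P_{\eta,m})e^{2\pi i n z}$ for $z\in\mathbb H$. Put $$C_{\eta\mathfrak a}=\left\{ac \;:\; \begin{pmatrix}a&b\\c&d\end{pmatrix}\in\sigma_\eta^{-1}\Gamma\sigma_{\mathfrak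 a}\right\},\qquad S^\star_{\eta\mathfrak a}(m,n;C)=\sum_{\substack{\gamma\in\Gamma_\eta\backslash\Gamma/\Gamma_{\mathfrak a}\\ \left(\begin{smallmatrix}a&b\\c&d\end{smallmatrix}\right)=\sigma_\eta^{-1}\gamma\sigma_{\mathfrak a},\ ac=C}}\mathbf e\left(\frac m{\ell_\eta}\log\left(\frac ac\right)+n\,\frac ba\right).$$ Then $0\notin C_{\eta\mathfrak a}$, the sums $S^\star_{\eta\mathfrak a}(m,n;C)$ are finite, and for every integer $n\ge1$ $$c_{\mathfrak a}(n;P_{\eta,m})=\frac{(2\pi i)^k n^{k-1}}{\Gamma(k)}\sum_{C\in C_{\eta\mathfrak a}}{}_1F_1\left(\frac k2+\frac{2\pi i m}{\ell_\eta};\,k;\,\frac{2\pi i n}{C}\right)\frac{S^\star_{\eta\mathfrak a}(m,n;C)}{C^{k/2}},$$ where the sum over $C$ converges absolutely, ${}_1F_1(\alpha;\beta;x)=\sum_{j\ge0}\frac{(\alpha)_j}{(\beta)_j}\frac{x^j}{j!}$ and $(\alpha)_j=\alpha(\alpha+1)\cdots(\alpha+j-1)$. -/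

import Mathlib

open scoped MatrixGroups UpperHalfPlane ModularForm
open MeasureTheory

noncomputable section

/-- The image in `GL(2, ℝ)` of an element of `SL(2, ℝ)`; it is through `GL(2, ℝ)` that Mathlib
defines the action on `ℝ ∪ {∞}` and the slash operator `f ∣[k] g`, which for determinant one is
`j(g, z)⁻ᵏ f(g z)`. -/
abbrev glOf (g : SL(2, ℝ)) : GL (Fin 2) ℝ := Matrix.SpecialLinearGroup.toGL g

/-- `Γ \ ℍ` has finite hyperbolic area: there is a measurable fundamental domain of finite area
(`volume` on `ℍ` is `y⁻² dx dy`; `±1` act trivially). -/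
def HasFiniteCovolume (Γ : Subgroup SL(2, ℝ)) : Prop :=
  ∃ F : Set ℍ, MeasurableSet F ∧ (∀ z : ℍ, ∃ γ ∈ Γ, γ • z ∈ F) ∧
    (∀ γ ∈ Γ, γ ≠ 1 → γ ≠ -1 → volume (F ∩ (fun z : ℍ => γ • z) '' F) = 0) ∧
    volume F < ⊤

/-- Fuchsian groups of the first kind: discrete subgroups of `SL(2, ℝ)` of finite covolume. -/
structure IsFuchsianFirstKind (Γ : Subgroup SL(2, ℝ)) : Prop where
  discrete : DiscreteTopology Γ
  finiteCovolume : HasFiniteCovolume Γ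

/-- `𝔞` is a cusp of `Γ`: it is fixed by a parabolic element of `Γ`. -/
def IsCuspOf (Γ : Subgroup SL(2, ℝ)) (𝔞 : OnePoint ℝ) : Prop :=
  ∃ γ ∈ Γ, (glOf γ).IsParabolic ∧ glOf γ • 𝔞 = 𝔞

/-- `(η₁, η₂)` is an ordered hyperbolic fixed pair of `Γ`: two distinct points of `ℝ ∪ {∞}` that
are both fixed by one hyperbolic element of `Γ`. -/
def IsHyperbolicPair (Γ : Subgroup SL(2, ℝ)) (η₁ η₂ : OnePoint ℝ) : Prop :=
  η₁ ≠ η₂ ∧ ∃ γ ∈ Γ, (glOf γ).IsHyperbolic ∧ glOf γ • η₁ = η₁ ∧ glOf γ • η₂ = η₂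

/-- The stabilizer `Γ_𝔞` of a point of `ℝ ∪ {∞}`, as a subgroup of `Γ`. -/
def cuspStab (Γ : Subgroup SL(2, ℝ)) (𝔞 : OnePoint ℝ) : Subgroup Γ :=
  (MulAction.stabilizer (GL (Fin 2) ℝ) 𝔞).comap
    (Matrix.SpecialLinearGroup.toGL.comp Γ.subtype)

/-- The subgroup `Γ_η` of the elements of `Γ` that fix both `η₁` and `η₂`. -/
def pairStab (Γ : Subgroup SL(2, ℝ)) (η₁ η₂ : OnePoint ℝ) : Subgroup Γ :=
  cuspStab Γ η₁ ⊓ cuspStab Γ η₂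

/-- `σ` is a scaling matrix for the cusp `𝔞`: `σ ∞ = 𝔞`, and up to signs `σ⁻¹ Γ_𝔞 σ` consists of
the matrices `(1 t; 0 1)` with `t ∈ ℤ`. -/
structure IsCuspScaling (Γ : Subgroup SL(2, ℝ)) (𝔞 : OnePoint ℝ) (σ : SL(2, ℝ)) : Prop where
  map_infty : glOf σ • (OnePoint.infty : OnePoint ℝ) = 𝔞
  conj : ∀ g : SL(2, ℝ),
    (∃ γ ∈ cuspStab Γ 𝔞, g = σ⁻¹ * (γ : SL(2, ℝ)) * σ ∨ g = -(σ⁻¹ * (γ : SL(2, ℝ)) * σ)) ↔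
    ∃ t : ℤ, (g : Matrix (Fin 2) (Fin 2) ℝ) = !![1, (t : ℝ); 0, 1] ∨
      (g : Matrix (Fin 2) (Fin 2) ℝ) = -!![1, (t : ℝ); 0, 1]

/-- `σ` is a scaling matrix for the hyperbolic pair `η` and `ℓ` is the length `ℓ_η`: `σ 0 = η₁`,
`σ ∞ = η₂`, `ℓ > 0`, and up to signs `σ⁻¹ Γ_η σ` consists of the matrices
`(exp (t ℓ / 2) 0; 0 exp (-t ℓ / 2))` with `t ∈ ℤ`. The last property determines `ℓ`. -/
structure IsHyperbolicScaling (Γ : Subgroup SL(2, ℝ)) (η₁ η₂ : OnePoint ℝ)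
    (σ : SL(2, ℝ)) (ℓ : ℝ) : Prop where
  map_zero : glOf σ • ((0 : ℝ) : OnePoint ℝ) = η₁
  map_infty : glOf σ • (OnePoint.infty : OnePoint ℝ) = η₂
  length_pos : 0 < ℓ
  conj : ∀ g : SL(2, ℝ),
    (∃ γ ∈ pairStab Γ η₁ η₂,
      g = σ⁻¹ * (γ : SL(2, ℝ)) * σ ∨ g = -(σ⁻¹ * (γ : SL(2, ℝ)) * σ)) ↔
    ∃ t : ℤ,
      (g : Matrix (Fin 2) (Fin 2) ℝ) =
        !![Real.exp (t * ℓ / 2), 0; 0, Real.exp (-(t * ℓ / 2))] ∨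
      (g : Matrix (Fin 2) (Fin 2) ℝ) =
        -!![Real.exp (t * ℓ / 2), 0; 0, Real.exp (-(t * ℓ / 2))]

/-- The summand of the hyperbolic Poincaré series: the function `z ^ (-k/2 + 2 π i m / ℓ)`
(principal branch) slashed in weight `k` with `σ_η⁻¹ γ`. -/
def hypPoincareTerm (k : ℕ) (ση : SL(2, ℝ)) (ℓ : ℝ) (m : ℤ) (γ : SL(2, ℝ)) (z : ℍ) : ℂ :=
  ((fun w : ℍ => (w : ℂ) ^ (-(k : ℂ) / 2 + 2 * Real.pi * Complex.I * m / ℓ)) ∣[(k : ℤ)]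
    glOf (ση⁻¹ * γ)) z

/-- The coset space `Γ_η \ Γ`. -/
abbrev PairCosets (Γ : Subgroup SL(2, ℝ)) (η₁ η₂ : OnePoint ℝ) : Type :=
  Quotient (QuotientGroup.rightRel (pairStab Γ η₁ η₂))

/-- The hyperbolic Poincaré series `P_{η, m}` of weight `k`, a sum over `Γ_η \ Γ`. For even `k`
the summand depends only on the coset, so that the choice of representatives is immaterial. -/
def hypPoincare (Γ : Subgroup SL(2, ℝ)) (k : ℕ) (η₁ η₂ : OnePoint ℝ) (ση : SL(2, ℝ)) (ℓ : ℝ)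
    (m : ℤ) (z : ℍ) : ℂ :=
  ∑' q : PairCosets Γ η₁ η₂, hypPoincareTerm k ση ℓ m (q.out : Γ) z

/-- `c` is the sequence of coefficients of the Fourier expansion of `f` at the cusp with scaling
matrix `σ`: `(f ∣ₖ σ)(z) = ∑ c j e^(2 π i j z)` on `ℍ`, summed over all integers `j`. -/
def HasParabolicExpansion (k : ℕ) (σ : SL(2, ℝ)) (f : ℍ → ℂ) (c : ℤ → ℂ) : Prop :=
  ∀ z : ℍ, HasSum (fun j : ℤ => c j * Complex.exp (2 * Real.pi * Complex.I * j * (z : ℂ)))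
    ((f ∣[(k : ℤ)] glOf σ) z)

/-- The set of the products `a c` over all `(a b; c d) ∈ σ_η⁻¹ Γ σ_𝔞`. -/
def moduliSet (Γ : Subgroup SL(2, ℝ)) (ση σa : SL(2, ℝ)) : Set ℝ :=
  {C | ∃ γ ∈ Γ, (ση⁻¹ * γ * σa) 0 0 * (ση⁻¹ * γ * σa) 1 0 = C}

/-- The double coset space `Γ_η \ Γ / Γ_𝔞`. -/
abbrev PairCuspCosets (Γ : Subgroup SL(2, ℝ)) (η₁ η₂ 𝔞 : OnePoint ℝ) : Type :=
  DoubleCoset.Quotient (pairStab Γ η₁ η₂ : Set Γ) (cuspStab Γ 𝔞 : Set Γ)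

/-- The matrix `σ_η⁻¹ γ σ_𝔞` for a representative `γ` of a double coset in `Γ_η \ Γ / Γ_𝔞`. -/
def repMatrix {Γ : Subgroup SL(2, ℝ)} {η₁ η₂ 𝔞 : OnePoint ℝ} (ση σa : SL(2, ℝ))
    (D : PairCuspCosets Γ η₁ η₂ 𝔞) : SL(2, ℝ) :=
  ση⁻¹ * ((Quotient.out D : Γ) : SL(2, ℝ)) * σa

/-- The double cosets in `Γ_η \ Γ / Γ_𝔞` whose matrices `(a b; c d)` have `a c = C`. -/
def cosetsWithModulus (Γ : Subgroup SL(2, ℝ)) (η₁ η₂ 𝔞 : OnePoint ℝ) (ση σa : SL(2, ℝ))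
    (C : ℝ) : Set (PairCuspCosets Γ η₁ η₂ 𝔞) :=
  {D | repMatrix ση σa D 0 0 * repMatrix ση σa D 1 0 = C}

/-- The renormalized hyperbolic/parabolic Kloosterman sum `S*(m, n; C)`: the sum of
`e((m / ℓ) log (a / c) + n b / a)` with `e(x) = exp (2 π i x)` and the principal logarithm, over
the double cosets of matrices `(a b; c d)` with `a c = C`. Both `a c` and the summand depend only
on the double coset. -/
def starKloosterman (Γ : Subgroup SL(2, ℝ)) (η₁ η₂ 𝔞 : OnePoint ℝ) (ση σa : SL(2, ℝ)) (ℓ : ℝ)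
    (m n : ℤ) (C : ℝ) : ℂ :=
  ∑ᶠ D ∈ cosetsWithModulus Γ η₁ η₂ 𝔞 ση σa C,
    Complex.exp (2 * Real.pi * Complex.I *
      ((m : ℂ) / ℓ * Complex.log ((repMatrix ση σa D 0 0 / repMatrix ση σa D 1 0 : ℝ) : ℂ) +
        n * ((repMatrix ση σa D 0 1 / repMatrix ση σa D 0 0 : ℝ) : ℂ)))

/-- The confluent hypergeometric function `₁F₁(a; b; x) = ∑ (a)_j / (b)_j * x ^ j / j!`. -/
def oneFOne (a b x : ℂ) : ℂ :=
  ∑' j : ℕ, (ascPochhammer ℂ j).eval a / (ascPochhammer ℂ j).eval b * x ^ j / (j.factorial : ℂ)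

end

/-! Unfold the Poincaré series along the cusp. Each coset of `Γ_η \ Γ` is, in exactly one way, that
of `γ δ_t`, with `γ` representing a double coset in `Γ_η \ Γ / Γ_𝔞` and `δ_t` acting as translation
by an integer `t` (`shiftEquiv`). With `(a b; c d) = σ_η⁻¹ γ σ_𝔞` and `w = z + b/a`, the determinant
gives `az + b = aw` and `cz + d = cw(1 + 1/(acw))`. Hence a term of the series is a constant times
`w⁻ᵏ (1 + r/w)^(-β)` with `r = 1/(ac)`, `β = k/2 + 2πim/ℓ` (`hypSlash_eq_doublePole`). Summing over
integer translates and expanding binomially, Lipschitz's formula term by term produces the `₁F₁`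
coefficient (`hasSum_periodizedDoublePole`), while the shift `b/a` produces the factor `e(nb/a)` of
the Kloosterman sum.

Convergence rests on `∑ ‖γ‖⁻⁴ < ∞` over a discrete group, a packing argument in the half plane
(`summable_inv_sqNorm_sq`). A term of the series is bounded by the inverse of `(a² + b²)(c² + d²)`,
which left dilations preserve. Choosing in each coset a representative with rows of comparable
length makes this product comparable to `‖·‖⁴` (`summable_inv_rowNormProd`).

Discreteness also gives `ac ≠ 0`: otherwise a parabolic and a hyperbolic element of `Γ` share a
fixed point, and conjugating one by powers of the other gives infinitely many elements of bounded
norm (`mul_ne_zero_of_scaling`). -/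

noncomputable section

/-! ### Convergence of `∑ ‖γ‖⁻⁴` over a discrete group -/

/-- The squared Frobenius norm of a matrix in `SL(2, ℝ)`. -/
def sqNorm (g : SL(2, ℝ)) : ℝ := g 0 0 ^ 2 + g 0 1 ^ 2 + (g 1 0 ^ 2 + g 1 1 ^ 2)

lemma SL2_det_eq_one (g : SL(2, ℝ)) : g 0 0 * g 1 1 - g 0 1 * g 1 0 = 1 := by
  have := g.det_coe
  rwa [Matrix.det_fin_two] at this

lemma sqNorm_nonneg (g : SL(2, ℝ)) : 0 ≤ sqNorm g := by unfold sqNorm; positivity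

lemma sqNorm_pos (g : SL(2, ℝ)) : 0 < sqNorm g := by
  have := SL2_det_eq_one g
  unfold sqNorm
  nlinarith [sq_nonneg (g 0 0 - g 1 1), sq_nonneg (g 0 1 + g 1 0)]

lemma sqNorm_mul_le (g h : SL(2, ℝ)) : sqNorm (g * h) ≤ sqNorm g * sqNorm h := by
  have key (a b c d : ℝ) : (a * c + b * d) ^ 2 ≤ (a ^ 2 + b ^ 2) * (c ^ 2 + d ^ 2) := by
    nlinarith [sq_nonneg (a * d - b * c)]
  simp only [sqNorm, Matrix.SpecialLinearGroup.coe_mul, Matrix.mul_apply, Fin.sum_univ_two]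
  nlinarith [key (g 0 0) (g 0 1) (h 0 0) (h 1 0), key (g 0 0) (g 0 1) (h 0 1) (h 1 1),
    key (g 1 0) (g 1 1) (h 0 0) (h 1 0), key (g 1 0) (g 1 1) (h 0 1) (h 1 1)]

lemma sqNorm_inv (g : SL(2, ℝ)) : sqNorm g⁻¹ = sqNorm g := by
  simp only [sqNorm, Matrix.SpecialLinearGroup.coe_inv, Matrix.adjugate_fin_two]
  simp
  ring

lemma coe_SL2_smul (g : SL(2, ℝ)) (z : ℍ) :
    ((g • z : ℍ) : ℂ) = (g 0 0 * z + g 0 1) / (g 1 0 * z + g 1 1) := by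
  simpa using UpperHalfPlane.coe_specialLinearGroup_apply g z

lemma SL2_denom_ne_zero (g : SL(2, ℝ)) (z : ℍ) : (g 1 0 * z + g 1 1 : ℂ) ≠ 0 :=
  UpperHalfPlane.denom_ne_zero (glOf g) z

lemma normSq_smul_I (g : SL(2, ℝ)) :
    ‖((g • UpperHalfPlane.I : ℍ) : ℂ)‖ ^ 2 =
      (g 0 0 ^ 2 + g 0 1 ^ 2) / (g 1 0 ^ 2 + g 1 1 ^ 2) := by
  rw [coe_SL2_smul, norm_div, div_pow, Complex.sq_norm, Complex.sq_norm]
  simp [Complex.normSq_apply, sq, add_comm]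

lemma im_smul_I (g : SL(2, ℝ)) :
    (g • UpperHalfPlane.I : ℍ).im = (g 1 0 ^ 2 + g 1 1 ^ 2)⁻¹ := by
  have h := SL2_det_eq_one g
  rw [← UpperHalfPlane.coe_im, coe_SL2_smul, Complex.div_im]
  simp only [Complex.normSq_apply]
  simp
  rw [← sub_div, inv_eq_one_div]
  congr 1
  linarith

lemma denom_sq_pos (g : SL(2, ℝ)) : 0 < g 1 0 ^ 2 + g 1 1 ^ 2 := by
  have := SL2_det_eq_one g
  by_contra! h0
  have h1 : g 1 0 = 0 := by nlinarith [sq_nonneg (g 1 0), sq_nonneg (g 1 1)]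
  have h2 : g 1 1 = 0 := by nlinarith [sq_nonneg (g 1 0), sq_nonneg (g 1 1)]
  simp [h1, h2] at this

lemma num_sq_pos (g : SL(2, ℝ)) : 0 < g 0 0 ^ 2 + g 0 1 ^ 2 := by
  have := SL2_det_eq_one g
  by_contra! h0
  have h1 : g 0 0 = 0 := by nlinarith [sq_nonneg (g 0 0), sq_nonneg (g 0 1)]
  have h2 : g 0 1 = 0 := by nlinarith [sq_nonneg (g 0 0), sq_nonneg (g 0 1)]
  simp [h1, h2] at this

lemma sqNorm_eq_div_im (g : SL(2, ℝ)) :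
    sqNorm g = (1 + ‖((g • UpperHalfPlane.I : ℍ) : ℂ)‖ ^ 2) / (g • UpperHalfPlane.I : ℍ).im := by
  have := denom_sq_pos g
  rw [normSq_smul_I, im_smul_I, sqNorm]
  field_simp
  ring

lemma sqNorm_eq_two_mul_cosh_dist (g : SL(2, ℝ)) :
    sqNorm g = 2 * Real.cosh (dist (g • UpperHalfPlane.I) UpperHalfPlane.I) := by
  have hpos := (g • UpperHalfPlane.I : ℍ).im_pos
  have hne := hpos.ne'
  rw [UpperHalfPlane.cosh_dist, sqNorm_eq_div_im, Complex.dist_eq, Complex.sq_norm, Complex.sq_norm,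
    Complex.normSq_apply, Complex.normSq_apply]
  simp only [Complex.sub_re, Complex.sub_im, UpperHalfPlane.coe_I, Complex.I_re, Complex.I_im,
    UpperHalfPlane.I_im, UpperHalfPlane.coe_re, UpperHalfPlane.coe_im]
  field_simp
  ring

/-- Since `sqNorm g = 2 cosh d(g i, i)`, a norm ball lies over a closed hyperbolic ball, so it is
compact by properness of the orbit map. -/
lemma finite_sqNorm_le (Γ : Subgroup SL(2, ℝ)) [DiscreteTopology Γ] (R : ℝ) :
    {γ : Γ | sqNorm γ ≤ R}.Finite := by
  have hK : IsCompact {g : SL(2, ℝ) | sqNorm g ≤ R} := by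
    have h1 := UpperHalfPlane.isProperMap_smul_I.isCompact_preimage
      (isCompact_closedBall UpperHalfPlane.I (Real.arcosh (R / 2)))
    refine h1.of_isClosed_subset ?_ ?_
    · have : Continuous sqNorm := by
        have hc : ∀ i j, Continuous fun g : SL(2, ℝ) => g i j := fun i j =>
          (continuous_apply_apply i j).comp continuous_subtype_val
        unfold sqNorm
        exact ((((hc 0 0).pow 2).add ((hc 0 1).pow 2)).add
          (((hc 1 0).pow 2).add ((hc 1 1).pow 2)))
      exact isClosed_le this continuous_const
    · intro g hg
      simp only [Set.mem_ofPred_eq, sqNorm_eq_two_mul_cosh_dist] at hg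
      simp only [Set.mem_preimage, Metric.mem_closedBall]
      have h2 : Real.cosh (dist (g • UpperHalfPlane.I) UpperHalfPlane.I) ≤ R / 2 := by linarith
      have h3 : 1 ≤ R / 2 := (Real.one_le_cosh _).trans h2
      rw [← Real.arcosh_cosh (dist_nonneg (x := g • UpperHalfPlane.I) (y := UpperHalfPlane.I))]
      exact (Real.arcosh_le_arcosh (by positivity) (by positivity)).2 h2
  have h := Subgroup.tendsto_coe_cofinite_of_discrete Γ
    (isDiscrete_iff_discreteTopology.2 inferInstance)
  have := h hK.compl_mem_cocompact
  simpa [Filter.mem_map, Filter.mem_cofinite, Set.compl_def] using this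

/-- If the two balls meet, their centres have comparable heights and `|p - q|² ≤ 2 im p im q`, so
`cosh d(p, q) ≤ 2`. -/
lemma sqNorm_inv_mul_le_of_mem_balls (g h : SL(2, ℝ)) (w : ℂ)
    (hg : w ∈ Metric.ball ((g • UpperHalfPlane.I : ℍ) : ℂ) ((g • UpperHalfPlane.I : ℍ).im / 4))
    (hh : w ∈ Metric.ball ((h • UpperHalfPlane.I : ℍ) : ℂ) ((h • UpperHalfPlane.I : ℍ).im / 4)) :
    sqNorm (g⁻¹ * h) ≤ 4 := by
  rw [sqNorm_eq_two_mul_cosh_dist, mul_smul, ← dist_smul g, smul_inv_smul,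
    UpperHalfPlane.cosh_dist]
  set p := (g • UpperHalfPlane.I : ℍ)
  set q := (h • UpperHalfPlane.I : ℍ)
  have hp := p.im_pos
  have hq := q.im_pos
  have hd : dist (q : ℂ) p ≤ (p.im + q.im) / 4 := by
    have := dist_triangle_left (q : ℂ) p w
    rw [Metric.mem_ball] at hg hh
    linarith
  have him : |q.im - p.im| ≤ dist (q : ℂ) p := by
    rw [Complex.dist_eq]
    simpa using Complex.abs_im_le_norm ((q : ℂ) - p)
  obtain ⟨h1, h2⟩ := abs_le.1 (him.trans hd)
  have : dist (q : ℂ) p ^ 2 / (2 * q.im * p.im) ≤ 1 := by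
    rw [div_le_one (by positivity)]
    have : dist (q : ℂ) p ^ 2 ≤ ((p.im + q.im) / 4) ^ 2 := by gcongr
    nlinarith
  linarith

/-- With `p = g i` one has `sqNorm g = (1 + |p|²) / im p`. The ball has area `π (im p)² / 16`, and
on it `|w| ≤ 5/4 |p|`, so the integral is at least a multiple of `(im p)² / (1 + |p|²)²`. The
constant `100` is generous. -/
lemma inv_sqNorm_sq_le_integral (g : SL(2, ℝ)) :
    (sqNorm g ^ 2)⁻¹ ≤ 100 * ∫ w : ℂ, (Metric.ball ((g • UpperHalfPlane.I : ℍ) : ℂ)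
      ((g • UpperHalfPlane.I : ℍ).im / 4)).indicator
        (fun w : ℂ => (1 + ‖w‖ ^ 2) ^ (-(4 : ℝ) / 2)) w := by
  have hint : Integrable (fun w : ℂ => (1 + ‖w‖ ^ 2) ^ (-(4 : ℝ) / 2)) :=
    integrable_rpow_neg_one_add_norm_sq (by simp [Complex.finrank_real_complex]; norm_num)
  rw [sqNorm_eq_div_im]
  set p := (g • UpperHalfPlane.I : ℍ)
  have hp := p.im_pos
  rw [integral_indicator Metric.isOpen_ball.measurableSet]
  have hpn : p.im ≤ ‖(p : ℂ)‖ := by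
    simpa [abs_of_pos hp] using Complex.abs_im_le_norm (p : ℂ)
  have hlow : ∀ w ∈ Metric.ball (p : ℂ) (p.im / 4),
      ((25 / 16 * (1 + ‖(p : ℂ)‖ ^ 2)) ^ 2)⁻¹ ≤ (1 + ‖w‖ ^ 2) ^ (-(4 : ℝ) / 2) := by
    intro w hw
    rw [show (-(4 : ℝ) / 2) = -((2 : ℕ) : ℝ) by norm_num, Real.rpow_neg (by positivity),
      Real.rpow_natCast]
    have h1 : ‖w‖ ≤ 5 / 4 * ‖(p : ℂ)‖ := by
      have := norm_sub_norm_le w (p : ℂ)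
      rw [Metric.mem_ball, Complex.dist_eq] at hw
      linarith
    have h2 : ‖w‖ ^ 2 ≤ (5 / 4 * ‖(p : ℂ)‖) ^ 2 := by gcongr
    gcongr
    nlinarith
  have := setIntegral_ge_of_const_le (μ := volume) Metric.isOpen_ball.measurableSet
    (by rw [Complex.volume_ball]; finiteness) hlow hint.integrableOn
  refine le_trans ?_ (mul_le_mul_of_nonneg_left this (by norm_num))
  rw [measureReal_def, Complex.volume_ball]
  simp only [ENNReal.toReal_mul, ENNReal.toReal_pow, ENNReal.coe_toReal, NNReal.coe_real_pi,
    smul_eq_mul]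
  rw [ENNReal.toReal_ofReal (by positivity)]
  have hpi := Real.pi_gt_three
  have e1 : (((1 + ‖(p : ℂ)‖ ^ 2) / p.im) ^ 2)⁻¹ = p.im ^ 2 * ((1 + ‖(p : ℂ)‖ ^ 2) ^ 2)⁻¹ := by
    field_simp
  have e2 : 100 * ((p.im / 4) ^ 2 * Real.pi * ((25 / 16 * (1 + ‖(p : ℂ)‖ ^ 2)) ^ 2)⁻¹) =
      (100 / 16 * (16 / 25) ^ 2 * Real.pi) * (p.im ^ 2 * ((1 + ‖(p : ℂ)‖ ^ 2) ^ 2)⁻¹) := by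
    field_simp
    norm_num
  rw [e1, e2]
  exact le_mul_of_one_le_left (by positivity) (by linarith)

lemma summable_inv_sqNorm_sq (Γ : Subgroup SL(2, ℝ)) [DiscreteTopology Γ] :
    Summable fun γ : Γ => (sqNorm γ ^ 2)⁻¹ := by
  classical
  set h : ℂ → ℝ := fun w => (1 + ‖w‖ ^ 2) ^ (-(4 : ℝ) / 2) with hh
  have hint : Integrable h :=
    integrable_rpow_neg_one_add_norm_sq (by simp [Complex.finrank_real_complex]; norm_num)
  have hpos : ∀ w, 0 ≤ h w := fun w => by simp only [hh]; positivity
  set B : SL(2, ℝ) → Set ℂ := fun g => Metric.ball ((g • UpperHalfPlane.I : ℍ) : ℂ)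
      ((g • UpperHalfPlane.I : ℍ).im / 4) with hB
  have hfin := finite_sqNorm_le Γ 4
  set N := hfin.toFinset.card
  refine summable_of_sum_le (c := 100 * ∫ w, N * h w) (fun γ => by positivity) fun s => ?_
  have hBint : ∀ γ : Γ, Integrable ((B γ).indicator h) := fun γ =>
    hint.indicator Metric.isOpen_ball.measurableSet
  calc ∑ γ ∈ s, (sqNorm γ ^ 2)⁻¹ ≤ ∑ γ ∈ s, 100 * ∫ w, (B γ).indicator h w :=
        Finset.sum_le_sum fun γ _ => inv_sqNorm_sq_le_integral _
    _ = 100 * ∫ w, ∑ γ ∈ s, (B γ).indicator h w := by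
        rw [← Finset.mul_sum, integral_finsetSum _ fun γ _ => hBint γ]
    _ ≤ 100 * ∫ w, N * h w := by
        refine mul_le_mul_of_nonneg_left (integral_mono
          (integrable_finsetSum _ fun γ _ => hBint γ) (hint.const_mul _) fun w => ?_) (by norm_num)
        simp only [Set.indicator_apply]
        rw [← Finset.sum_filter, Finset.sum_const, nsmul_eq_mul]
        refine mul_le_mul_of_nonneg_right ?_ (hpos w)
        rcases (s.filter fun γ : Γ => w ∈ B γ).eq_empty_or_nonempty with he | ⟨γ₀, h₀⟩
        · simp [he]
        -- Bounded overlap: once `w` lies in the ball of `γ₀`, every other ball through `w` comes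
        -- from `γ₀` times one of the `N` elements with `sqNorm ≤ 4`.
        · refine Nat.cast_le.2 (Finset.card_le_card_of_injOn (fun γ => γ₀⁻¹ * γ) ?_ ?_)
          · intro γ hγ
            simp only [Finset.coe_filter, Set.mem_ofPred_eq, Finset.mem_filter] at hγ h₀
            simp only [Set.Finite.coe_toFinset, Set.mem_ofPred_eq]
            exact sqNorm_inv_mul_le_of_mem_balls _ _ w h₀.2 hγ.2
          · exact fun _ _ _ _ h => mul_left_cancel h

lemma summable_inv_sqNorm_mul_mul_sq (Γ : Subgroup SL(2, ℝ)) [DiscreteTopology Γ]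
    (A B : SL(2, ℝ)) : Summable fun γ : Γ => (sqNorm (A * γ * B) ^ 2)⁻¹ := by
  refine Summable.of_nonneg_of_le (fun γ => by positivity) (fun γ => ?_)
    ((summable_inv_sqNorm_sq Γ).mul_left ((sqNorm A * sqNorm B) ^ 2))
  have h1 : sqNorm (γ : SL(2, ℝ)) ≤ sqNorm A * sqNorm B * sqNorm (A * γ * B) := by
    have e : (γ : SL(2, ℝ)) = A⁻¹ * (A * γ * B) * B⁻¹ := by group
    calc sqNorm (γ : SL(2, ℝ)) = sqNorm (A⁻¹ * (A * γ * B) * B⁻¹) := by rw [← e]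
      _ ≤ sqNorm (A⁻¹ * (A * γ * B)) * sqNorm B⁻¹ := sqNorm_mul_le _ _
      _ ≤ sqNorm A⁻¹ * sqNorm (A * γ * B) * sqNorm B⁻¹ :=
        mul_le_mul_of_nonneg_right (sqNorm_mul_le _ _) (sqNorm_nonneg _)
      _ = _ := by rw [sqNorm_inv, sqNorm_inv]; ring
  have hγ := sqNorm_pos (γ : SL(2, ℝ))
  have hM := sqNorm_pos (A * γ * B)
  rw [← div_eq_mul_inv, inv_eq_one_div, div_le_div_iff₀ (by positivity) (by positivity), one_mul,
    ← mul_pow]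
  gcongr

/-! ### The double pole and its periodization -/

/-- The function `w ↦ w⁻ᵏ (1 + r / w)^(-β)`, holomorphic on the upper half plane. -/
def doublePole (k : ℕ) (β : ℂ) (r : ℝ) (w : ℂ) : ℂ := (w ^ k)⁻¹ * (1 + r / w) ^ (-β)

lemma ne_zero_of_im_pos {w : ℂ} (hw : 0 < w.im) : w ≠ 0 := by
  rintro rfl
  simp at hw

lemma one_add_div_mem_slitPlane (r : ℝ) {w : ℂ} (hw : 0 < w.im) :
    1 + (r : ℂ) / w ∈ Complex.slitPlane := by
  rcases eq_or_ne r 0 with rfl | hr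
  · simp
  · right
    have hpos : 0 < Complex.normSq w := Complex.normSq_pos.2 (ne_zero_of_im_pos hw)
    simp [Complex.div_im, hr, hw.ne', hpos.ne']

lemma norm_cpow_le_of_norm_mem {x p : ℂ} {A : ℝ} (hA : 1 ≤ A) (h1 : A⁻¹ ≤ ‖x‖) (h2 : ‖x‖ ≤ A) :
    ‖x ^ p‖ ≤ A ^ |p.re| * Real.exp (Real.pi * |p.im|) := by
  have hA0 : 0 < A := by linarith
  have hx : 0 < ‖x‖ := (inv_pos.2 hA0).trans_le h1
  refine (Complex.norm_cpow_le x p).trans ?_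
  rw [div_eq_mul_inv, ← Real.exp_neg]
  refine mul_le_mul ?_ ?_ (by positivity) (by positivity)
  · rcases le_total 0 p.re with h | h
    · rw [abs_of_nonneg h]
      exact Real.rpow_le_rpow hx.le h2 h
    · rw [abs_of_nonpos h, ← inv_inv A, Real.inv_rpow (by positivity), ← Real.rpow_neg (by positivity),
        neg_neg]
      exact Real.rpow_le_rpow_of_nonpos (by positivity) h1 h
  · refine Real.exp_le_exp.2 ((neg_le_abs _).trans ?_)
    rw [abs_mul]
    exact mul_le_mul_of_nonneg_right (Complex.abs_arg_le_pi _) (abs_nonneg _)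

/-- Both `w` and `w + r` have height at least `ε`, so `(w + r) / w` and its inverse are bounded by
`1 + |r|/ε`, uniformly in the real part of `w`. -/
lemma norm_one_add_div_cpow_le (β : ℂ) (r : ℝ) {ε : ℝ} (hε : 0 < ε) {w : ℂ} (hw : ε ≤ w.im) :
    ‖(1 + (r : ℂ) / w) ^ (-β)‖ ≤ (1 + |r| / ε) ^ |β.re| * Real.exp (Real.pi * |β.im|) := by
  have hw0 : w ≠ 0 := ne_zero_of_im_pos (hε.trans_le hw)
  have hwn : ε ≤ ‖w‖ := hw.trans ((le_abs_self _).trans (Complex.abs_im_le_norm w))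
  have hwr : ε ≤ ‖w + r‖ := by
    refine hw.trans ((le_abs_self _).trans ?_)
    simpa using Complex.abs_im_le_norm (w + r)
  have e : 1 + (r : ℂ) / w = (w + r) / w := by field_simp
  have key {s u : ℂ} (hu : ε ≤ ‖u‖) (h : ‖s‖ ≤ ‖u‖ + |r|) : ‖s‖ / ‖u‖ ≤ 1 + |r| / ε := by
    have hu0 : 0 < ‖u‖ := hε.trans_le hu
    rw [div_le_iff₀ hu0]
    have : |r| ≤ |r| / ε * ‖u‖ := by
      rw [div_mul_eq_mul_div, le_div_iff₀ hε]
      exact mul_le_mul_of_nonneg_left hu (abs_nonneg _)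
    linarith
  have := norm_cpow_le_of_norm_mem (x := 1 + (r : ℂ) / w) (p := -β) (A := 1 + |r| / ε)
    (by have : 0 ≤ |r| / ε := by positivity
        linarith) ?_ ?_
  · simpa using this
  · rw [e, norm_div, inv_le_comm₀ (by positivity)
      (div_pos (hε.trans_le hwr) (hε.trans_le hwn)), inv_div]
    refine key hwr ?_
    have := norm_sub_le (w + r) (r : ℂ)
    simpa using this
  · rw [e, norm_div]
    refine key hwn ?_
    have := norm_add_le w (r : ℂ)
    simpa using this

/-- As a quadratic form in `(a, b)`, `|az + b|²` has determinant `(im z)²` and trace `|z|² + 1`; its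
least eigenvalue is at least their quotient. It is used for the translates `z + t` and for the rows
of a matrix. -/
lemma sq_add_sq_le_mul_normSq (a b : ℝ) (z : ℂ) :
    z.im ^ 2 * (a ^ 2 + b ^ 2) ≤ (‖z‖ ^ 2 + 1) * ‖(a : ℂ) * z + b‖ ^ 2 := by
  rw [Complex.sq_norm, Complex.sq_norm, Complex.normSq_apply, Complex.normSq_apply]
  simp
  nlinarith [sq_nonneg ((z.re ^ 2 + z.im ^ 2) * a + z.re * b), sq_nonneg (z.re * a + b)]

lemma exists_norm_pow_inv_translate_le {k : ℕ} (hk : 2 ≤ k) {ε X : ℝ} (hε : 0 < ε) :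
    ∃ K, 0 ≤ K ∧ ∀ z : ℂ, ε ≤ z.im → |z.re| ≤ X → ∀ t : ℤ,
      ‖((z + t) ^ k)⁻¹‖ ≤ K * (1 + (t : ℝ) ^ 2)⁻¹ := by
  -- Two of the `k` factors supply the decay in `t`; the remaining `k - 2` are bounded by the height
  -- alone.
  refine ⟨(ε ^ (k - 2))⁻¹ * ((X ^ 2 + ε ^ 2 + 1) / ε ^ 2), by positivity, fun z hz hX t => ?_⟩
  have h1 : ε ≤ ‖z + t‖ := by
    refine hz.trans ((le_abs_self _).trans ?_)
    simpa using Complex.abs_im_le_norm (z + t)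
  have h0 : 0 < ‖z + t‖ := hε.trans_le h1
  have h2 : ε ^ 2 * (1 + (t : ℝ) ^ 2) ≤ (X ^ 2 + ε ^ 2 + 1) * ‖z + t‖ ^ 2 := by
    have h := sq_add_sq_le_mul_normSq 1 t z
    simp only [Complex.ofReal_one, one_mul, one_pow, Complex.ofReal_intCast] at h
    have hz2 : ‖z‖ ^ 2 ≤ X ^ 2 + z.im ^ 2 := by
      rw [Complex.sq_norm, Complex.normSq_apply]
      have : z.re ^ 2 ≤ X ^ 2 := sq_le_sq' (neg_le_of_abs_le hX) (le_of_abs_le hX)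
      nlinarith
    have h3 : ε ^ 2 ≤ z.im ^ 2 := by gcongr
    have him : 0 < z.im := hε.trans_le hz
    have h4 : z.im ^ 2 * (1 + (t : ℝ) ^ 2) ≤ (X ^ 2 + z.im ^ 2 + 1) * ‖z + t‖ ^ 2 :=
      h.trans (by gcongr)
    have h5 : 1 + (t : ℝ) ^ 2 ≤ ((X ^ 2 + 1) / ε ^ 2 + 1) * ‖z + t‖ ^ 2 := by
      have h6 : 1 + (t : ℝ) ^ 2 ≤ (X ^ 2 + z.im ^ 2 + 1) / z.im ^ 2 * ‖z + t‖ ^ 2 := by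
        rw [div_mul_eq_mul_div, le_div_iff₀ (by positivity)]
        linarith
      refine h6.trans (mul_le_mul_of_nonneg_right ?_ (by positivity))
      have : (X ^ 2 + z.im ^ 2 + 1) / z.im ^ 2 = (X ^ 2 + 1) / z.im ^ 2 + 1 := by
        field_simp
        ring
      rw [this]
      gcongr
    calc ε ^ 2 * (1 + (t : ℝ) ^ 2) ≤ ε ^ 2 * (((X ^ 2 + 1) / ε ^ 2 + 1) * ‖z + t‖ ^ 2) := by gcongr
      _ = _ := by field_simp; ring
  have h3 : ‖z + t‖ ^ k = ‖z + t‖ ^ (k - 2) * ‖z + t‖ ^ 2 := by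
    rw [← pow_add]
    congr 1
    omega
  rw [norm_inv, norm_pow, h3, mul_inv, mul_assoc]
  refine mul_le_mul (by gcongr) ?_ (by positivity) (by positivity)
  rw [inv_eq_one_div, ← div_eq_mul_inv, div_div, div_le_div_iff₀ (by positivity) (by positivity)]
  linarith

lemma summable_one_add_int_sq_inv : Summable fun t : ℤ => (1 + (t : ℝ) ^ 2)⁻¹ := by
  have h := (Real.summable_one_div_int_pow (p := 2)).2 one_lt_two
  refine Summable.of_norm_bounded_eventually h ?_
  have : ({0} : Set ℤ).Finite := Set.finite_singleton 0
  filter_upwards [this.compl_mem_cofinite] with t ht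
  have ht : (t : ℝ) ≠ 0 := by simpa using ht
  rw [Real.norm_of_nonneg (by positivity), one_div]
  gcongr
  linarith

lemma exists_norm_doublePole_translate_le {k : ℕ} (hk : 2 ≤ k) (β : ℂ) (r : ℝ) {ε X : ℝ}
    (hε : 0 < ε) : ∃ K, 0 ≤ K ∧ ∀ z : ℂ, ε ≤ z.im → |z.re| ≤ X → ∀ t : ℤ,
      ‖doublePole k β r (z + t)‖ ≤ K * (1 + (t : ℝ) ^ 2)⁻¹ := by
  obtain ⟨K, hK, h⟩ := exists_norm_pow_inv_translate_le hk (X := X) hε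
  refine ⟨K * ((1 + |r| / ε) ^ |β.re| * Real.exp (Real.pi * |β.im|)), by positivity,
    fun z hz hX t => ?_⟩
  rw [doublePole, norm_mul, mul_right_comm]
  refine mul_le_mul (h z hz hX t) ?_ (norm_nonneg _) (by positivity)
  exact norm_one_add_div_cpow_le β r hε (by simpa using hz)

/-- The sum of `doublePole` over all integer translates. -/
def periodizedDoublePole (k : ℕ) (β : ℂ) (r : ℝ) (z : ℍ) : ℂ :=
  ∑' t : ℤ, doublePole k β r (z + t)

lemma differentiableAt_doublePole (k : ℕ) (β : ℂ) (r : ℝ) {w : ℂ} (hw : 0 < w.im) :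
    DifferentiableAt ℂ (doublePole k β r) w := by
  have hw0 := ne_zero_of_im_pos hw
  unfold doublePole
  refine ((differentiableAt_id.pow k).inv (pow_ne_zero k hw0)).mul
    (DifferentiableAt.cpow_const ?_ (one_add_div_mem_slitPlane r hw))
  exact (differentiableAt_const _).add ((differentiableAt_const _).div differentiableAt_id hw0)

open UpperHalfPlane Manifold in
lemma mdifferentiable_periodizedDoublePole {k : ℕ} (hk : 2 ≤ k) (β : ℂ) (r : ℝ) :
    MDiff (periodizedDoublePole k β r) := by
  rw [UpperHalfPlane.mdifferentiable_iff]
  intro z₀ hz₀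
  have hz₀ : 0 < z₀.im := hz₀
  obtain ⟨K, hK, h⟩ := exists_norm_doublePole_translate_le hk β r (X := |z₀.re| + 1)
    (half_pos hz₀)
  set U : Set ℂ := {z | z₀.im / 2 < z.im} ∩ {z | |z.re| < |z₀.re| + 1} with hU
  have hUo : IsOpen U := (isOpen_lt continuous_const Complex.continuous_im).inter
    (isOpen_lt (continuous_abs.comp Complex.continuous_re) continuous_const)
  have hmem : z₀ ∈ U := ⟨by simp only [Set.mem_ofPred_eq]; linarith,
    by simp only [Set.mem_ofPred_eq]; linarith⟩
  have hpos : ∀ z ∈ U, 0 < z.im := fun z hz => (half_pos hz₀).trans hz.1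
  have hd : DifferentiableOn ℂ (fun z => ∑' t : ℤ, doublePole k β r (z + t)) U := by
    refine Complex.differentiableOn_tsum_of_summable_norm
      (summable_one_add_int_sq_inv.mul_left K) (fun t z hz => ?_) hUo
      fun t z hz => h z hz.1.le hz.2.le t
    refine DifferentiableAt.differentiableWithinAt ?_
    have : DifferentiableAt ℂ (doublePole k β r) (z + t) :=
      differentiableAt_doublePole k β r (by simpa using hpos z hz)
    exact this.comp z (differentiableAt_id.add_const _)
  refine ((hd.differentiableAt (hUo.mem_nhds hmem)).congr_of_eventuallyEq ?_).differentiableWithinAt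
  filter_upwards [hUo.mem_nhds hmem] with z hz
  simp [periodizedDoublePole, UpperHalfPlane.ofComplex_apply_of_im_pos (hpos z hz)]

lemma periodizedDoublePole_add_int (k : ℕ) (β : ℂ) (r : ℝ) {z w : ℍ} (n : ℤ)
    (h : (w : ℂ) = z + n) : periodizedDoublePole k β r w = periodizedDoublePole k β r z := by
  unfold periodizedDoublePole
  rw [h, ← (Equiv.addLeft n).tsum_eq fun t : ℤ => doublePole k β r ((z : ℂ) + t)]
  refine tsum_congr fun t => ?_
  simp [add_assoc]

open UpperHalfPlane in
lemma periodic_periodizedDoublePole (k : ℕ) (β : ℂ) (r : ℝ) :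
    Function.Periodic (periodizedDoublePole k β r ∘ ofComplex) ((1 : ℝ) : ℂ) := by
  intro w
  by_cases! hw : 0 < w.im
  · have hw' : 0 < (w + (1 : ℝ)).im := by simp [hw]
    simp only [Function.comp_apply, ofComplex_apply_of_im_pos hw', ofComplex_apply_of_im_pos hw]
    exact periodizedDoublePole_add_int k β r 1 (by simp)
  · have : (w + (1 : ℝ)).im ≤ 0 := by simpa using hw
    simp only [Function.comp_apply, ofComplex_apply_of_im_nonpos this,
      ofComplex_apply_of_im_nonpos hw]

lemma isBoundedAtImInfty_periodizedDoublePole {k : ℕ} (hk : 2 ≤ k) (β : ℂ) (r : ℝ) :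
    UpperHalfPlane.IsBoundedAtImInfty (periodizedDoublePole k β r) := by
  rw [UpperHalfPlane.isBoundedAtImInfty_iff]
  obtain ⟨K, hK, h⟩ := exists_norm_doublePole_translate_le hk β r (X := 1) one_pos
  refine ⟨∑' t : ℤ, K * (1 + (t : ℝ) ^ 2)⁻¹, 1, fun z hz => ?_⟩
  -- Periodicity brings `z` into the strip where the bound on translates is uniform.
  let w : ℍ := ⟨z + (-⌊z.re⌋ : ℤ), by simpa using z.im_pos⟩
  rw [← periodizedDoublePole_add_int k β r (z := z) (w := w) (-⌊z.re⌋) rfl]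
  have hw : |(w : ℂ).re| ≤ 1 := by
    simp only [w, Complex.add_re, Complex.intCast_re, UpperHalfPlane.coe_re]
    rw [abs_le, Int.cast_neg]
    constructor <;> linarith [Int.floor_le z.re, Int.lt_floor_add_one z.re]
  refine tsum_of_norm_bounded (summable_one_add_int_sq_inv.mul_left K).hasSum
    fun t => h w (by simpa [w] using hz) hw t

/-! ### Coefficients of exponential series -/

lemma integral_exp_two_pi_int_mul (n : ℤ) :
    ∫ u in (0 : ℝ)..1, Complex.exp (2 * Real.pi * Complex.I * n * u) = if n = 0 then 1 else 0 := by
  split_ifs with h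
  · simp [h]
  · have hc : (2 * Real.pi * Complex.I * n : ℂ) ≠ 0 := by simp [h, Real.pi_ne_zero]
    rw [integral_exp_mul_complex hc]
    simp only [Complex.ofReal_one, mul_one, Complex.ofReal_zero, mul_zero, Complex.exp_zero]
    rw [mul_comm, Complex.exp_int_mul_two_pi_mul_I]
    simp

lemma norm_exp_two_pi_int_mul (n : ℤ) (z : ℂ) :
    ‖Complex.exp (2 * Real.pi * Complex.I * n * z)‖ = Real.exp (-2 * Real.pi * n * z.im) := by
  rw [Complex.norm_exp]
  congr 1
  have : 2 * Real.pi * Complex.I * n * z = ((2 * Real.pi * n : ℝ) : ℂ) * (Complex.I * z) := by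
    push_cast
    ring
  rw [this, Complex.re_ofReal_mul]
  simp

/-- A coefficient of an exponential series is an integral along a horizontal segment. -/
lemma integral_exp_mul_eq_of_hasSum {ι : Type*} [Countable ι] {ν : ι → ℤ}
    (hν : Function.Injective ν) {a : ι → ℂ} {y : ℝ} {g : ℝ → ℂ}
    (h : ∀ u : ℝ, HasSum
      (fun i => a i * Complex.exp (2 * Real.pi * Complex.I * ν i * (u + y * Complex.I))) (g u))
    (i₀ : ι) : ∫ u in (0 : ℝ)..1,
      Complex.exp (-(2 * Real.pi * Complex.I * ν i₀ * (u + y * Complex.I))) * g u = a i₀ := by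
  classical
  -- The norms of the terms depend only on the height, so convergence at `u = 0` dominates the whole
  -- segment.
  have hs : Summable fun i => ‖a i‖ * Real.exp (-2 * Real.pi * ν i * y) := by
    have := (h 0).summable.norm
    refine this.congr fun i => ?_
    rw [norm_mul, norm_exp_two_pi_int_mul]
    simp
  have key := intervalIntegral.hasSum_integral_of_dominated_convergence (μ := volume)
    (a := 0) (b := 1)
    (F := fun i u => Complex.exp (-(2 * Real.pi * Complex.I * ν i₀ * (u + y * Complex.I))) *
      (a i * Complex.exp (2 * Real.pi * Complex.I * ν i * (u + y * Complex.I))))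
    (f := fun u : ℝ =>
      Complex.exp (-(2 * Real.pi * Complex.I * ν i₀ * (u + y * Complex.I))) * g u)
    (fun i _ => Real.exp (2 * Real.pi * ν i₀ * y) *
      (‖a i‖ * Real.exp (-2 * Real.pi * ν i * y)))
    (fun i => (by fun_prop : Continuous _).aestronglyMeasurable)
    (fun i => Filter.Eventually.of_forall fun u _ => by
      rw [norm_mul, norm_mul, Complex.exp_neg, norm_inv, norm_exp_two_pi_int_mul,
        norm_exp_two_pi_int_mul, ← Real.exp_neg]
      simp)
    (Filter.Eventually.of_forall fun u _ => hs.mul_left _)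
    (by simp)
    (Filter.Eventually.of_forall fun u _ => (h u).mul_left _)
  have hval : ∀ i, ∫ u in (0 : ℝ)..1,
      Complex.exp (-(2 * Real.pi * Complex.I * ν i₀ * (u + y * Complex.I))) *
      (a i * Complex.exp (2 * Real.pi * Complex.I * ν i * (u + y * Complex.I))) =
      if i = i₀ then a i₀ else 0 := by
    intro i
    have e : ∀ u : ℝ, Complex.exp (-(2 * Real.pi * Complex.I * ν i₀ * (u + y * Complex.I))) *
      (a i * Complex.exp (2 * Real.pi * Complex.I * ν i * (u + y * Complex.I))) =
      (a i * Complex.exp (2 * Real.pi * Complex.I * (ν i - ν i₀ : ℤ) * (y * Complex.I))) *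
        Complex.exp (2 * Real.pi * Complex.I * (ν i - ν i₀ : ℤ) * u) := by
      intro u
      rw [mul_left_comm, mul_assoc (a i), ← Complex.exp_add, ← Complex.exp_add]
      congr 2
      push_cast
      ring
    simp_rw [e]
    rw [intervalIntegral.integral_const_mul, integral_exp_two_pi_int_mul]
    by_cases hi : i = i₀
    · simp [hi]
    · have : ν i - ν i₀ ≠ 0 := sub_ne_zero.2 (hν.ne hi)
      simp [hi, this]
  simp_rw [hval] at key
  exact key.unique (hasSum_ite_eq i₀ (a i₀))

/-- Cauchy's estimate, from the integral formula for the coefficient. -/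
lemma norm_le_of_hasSum_exp {ι : Type*} [Countable ι] {ν : ι → ℤ}
    (hν : Function.Injective ν) {a : ι → ℂ} {y : ℝ} {g : ℝ → ℂ} {B : ℝ}
    (h : ∀ u : ℝ, HasSum
      (fun i => a i * Complex.exp (2 * Real.pi * Complex.I * ν i * (u + y * Complex.I))) (g u))
    (hB : ∀ u ∈ Set.Icc (0 : ℝ) 1, ‖g u‖ ≤ B) (i₀ : ι) :
    ‖a i₀‖ ≤ Real.exp (2 * Real.pi * ν i₀ * y) * B := by
  rw [← integral_exp_mul_eq_of_hasSum hν h i₀]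
  have := intervalIntegral.norm_integral_le_of_norm_le_const (a := (0 : ℝ)) (b := 1)
    (f := fun u : ℝ =>
      Complex.exp (-(2 * Real.pi * Complex.I * ν i₀ * (u + y * Complex.I))) * g u)
    (C := Real.exp (2 * Real.pi * ν i₀ * y) * B) fun u hu => by
      rw [Set.uIoc_of_le zero_le_one] at hu
      rw [norm_mul, Complex.exp_neg, norm_inv, norm_exp_two_pi_int_mul, ← Real.exp_neg]
      simp only [Complex.add_im, Complex.ofReal_im, Complex.mul_im, Complex.ofReal_re,
        Complex.I_im, mul_one, Complex.I_re, mul_zero, add_zero, zero_add, neg_mul, neg_neg]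
      exact mul_le_mul_of_nonneg_left (hB u ⟨hu.1.le, hu.2⟩) (Real.exp_nonneg _)
  simpa using this

/-! ### Fourier expansion of the periodized double pole -/

lemma choose_neg_eq_ascPochhammer (β : ℂ) (j : ℕ) :
    Ring.choose (-β) j = (-1) ^ j * (ascPochhammer ℂ j).eval β / j.factorial := by
  have h1 := Ring.descPochhammer_eq_factorial_smul_choose (-β) j
  have h2 := ascPochhammer_eval_neg_eq_descPochhammer ℂ (-β) j
  rw [neg_neg] at h2
  have h3 : (descPochhammer ℤ j).smeval (-β) = (descPochhammer ℂ j).eval (-β) := by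
    rw [← descPochhammer_map (Int.castRingHom ℂ), Polynomial.eval_map,
      ← Polynomial.eval₂_smulOneHom_eq_smeval]
    congr 1
    ext
    simp
  rw [h3, nsmul_eq_mul] at h1
  rw [h2, ← mul_assoc, ← mul_pow, neg_mul_neg, one_mul, one_pow, one_mul, h1]
  field_simp [Nat.factorial_ne_zero]

lemma hasSum_one_add_cpow (p : ℂ) {x : ℂ} (hx : ‖x‖ < 1) :
    HasSum (fun j : ℕ => Ring.choose p j * x ^ j) ((1 + x) ^ p) := by
  have h := (Complex.one_add_cpow_hasFPowerSeriesOnBall_zero (a := p)).hasSum (y := x)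
    (by rw [← ENNReal.ofReal_one, Metric.eball_ofReal]; simpa using hx)
  simp only [binomialSeries_apply, List.ofFn_const, List.prod_replicate, smul_eq_mul,
    zero_add] at h
  exact h

lemma summable_norm_choose_mul_pow (p : ℂ) {ρ : ℝ} (h0 : 0 ≤ ρ) (h1 : ρ < 1) :
    Summable fun j : ℕ => ‖Ring.choose p j‖ * ρ ^ j := by
  have := (hasSum_one_add_cpow p (x := (ρ : ℂ)) (by simpa [abs_of_nonneg h0] using h1)).summable.norm
  simpa [abs_of_nonneg h0] using this

/-- The `n`-th Fourier coefficient of `periodizedDoublePole`. -/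
def doublePoleCoeff (k : ℕ) (β : ℂ) (r : ℝ) (n : ℕ) : ℂ :=
  (-2 * Real.pi * Complex.I) ^ k * (n : ℂ) ^ (k - 1) / Complex.Gamma k *
    oneFOne β k (2 * Real.pi * Complex.I * n * r)

/-- The term of index `(j, n)` in the double expansion, binomial in `j` and Fourier in `n`, of
`periodizedDoublePole`. -/
def doublePoleTerm (k : ℕ) (β : ℂ) (r : ℝ) (q : ℂ) (j n : ℕ) : ℂ :=
  Ring.choose (-β) j * (r : ℂ) ^ j * ((-2 * Real.pi * Complex.I) ^ (k + j) / (k + j - 1).factorial *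
    ((n : ℂ) ^ (k + j - 1) * q ^ n))

/-- Lipschitz's formula. -/
lemma tsum_translate_pow_inv {N : ℕ} (hN : 2 ≤ N) (z : ℍ) :
    ∑' t : ℤ, (((z : ℂ) + t) ^ N)⁻¹ = (-2 * Real.pi * Complex.I) ^ N / (N - 1).factorial *
      ∑' n : ℕ, (n : ℂ) ^ (N - 1) * Complex.exp (2 * Real.pi * Complex.I * z) ^ n := by
  have := EisensteinSeries.qExpansion_identity (k := N - 1) (by omega) z
  rw [Nat.sub_add_cancel (by omega)] at this
  simpa using this

lemma summable_pow_mul_exp_pow (N : ℕ) (z : ℍ) :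
    Summable fun n : ℕ => (n : ℂ) ^ N * Complex.exp (2 * Real.pi * Complex.I * z) ^ n := by
  simpa using summable_pow_mul_cexp N 1 z

/-- The binomial coefficient gives `(-1)ʲ (β)_j / j!` and Lipschitz's formula gives `1 / (k + j -
1)!`, which is `1 / ((k)_j (k - 1)!)`. The sign `(-1)ʲ` turns `(-2πi)ʲ` into `(2πi)ʲ`, leaving a
`₁F₁` series. -/
lemma tsum_doublePoleTerm_eq_coeff {k : ℕ} (hk : 1 ≤ k) (β : ℂ) (r : ℝ) (q : ℂ) (n : ℕ) :
    ∑' j, doublePoleTerm k β r q j n = doublePoleCoeff k β r n * q ^ n := by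
  unfold doublePoleCoeff oneFOne
  rw [← tsum_mul_left, ← tsum_mul_right]
  refine tsum_congr fun j => ?_
  obtain ⟨k, rfl⟩ : ∃ k', k = k' + 1 := ⟨k - 1, by omega⟩
  have hg : Complex.Gamma ((k + 1 : ℕ) : ℂ) = k.factorial := by
    rw [Nat.cast_add, Nat.cast_one, Complex.Gamma_nat_eq_factorial]
  have hp : (ascPochhammer ℂ j).eval ((k + 1 : ℕ) : ℂ) = (k + j).factorial / k.factorial := by
    rw [← ascPochhammer_eval_cast, ascPochhammer_nat_eq_ascFactorial, eq_div_iff (by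
      exact_mod_cast Nat.factorial_ne_zero k), mul_comm]
    exact_mod_cast Nat.factorial_mul_ascFactorial k j
  rw [doublePoleTerm, choose_neg_eq_ascPochhammer, hg, hp,
    show k + 1 + j - 1 = k + j by omega, show k + 1 - 1 = k by omega]
  have h1 : (k.factorial : ℂ) ≠ 0 := by exact_mod_cast Nat.factorial_ne_zero k
  have h2 : ((k + j).factorial : ℂ) ≠ 0 := by exact_mod_cast Nat.factorial_ne_zero _
  have h3 : (j.factorial : ℂ) ≠ 0 := by exact_mod_cast Nat.factorial_ne_zero _
  have h4 : (2 * Real.pi * Complex.I * n * r) ^ j =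
      (-1) ^ j * ((-2 * Real.pi * Complex.I) ^ j * (n : ℂ) ^ j * (r : ℂ) ^ j) := by
    rw [← mul_pow, ← mul_pow, ← mul_pow]
    congr 1
    ring
  rw [h4, pow_add _ (k + 1) j, pow_add _ k j]
  field_simp

/-- At `z = iy` the variable `q` is positive, so the series of absolute values is itself a Lipschitz
sum, and the other side of the formula bounds it. With `N = k + j` the bound decays like `y⁻ʲ`,
which beats the factorials implicitly. -/
lemma tsum_pow_mul_exp_pow_le {N : ℕ} (hN : 2 ≤ N) {y : ℝ} (hy : 0 < y) :
    (2 * Real.pi) ^ N / (N - 1).factorial *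
      ∑' n : ℕ, (n : ℝ) ^ (N - 1) * Real.exp (-2 * Real.pi * y) ^ n ≤
    (∑' t : ℤ, ‖((y * Complex.I + t : ℂ) ^ 2)⁻¹‖) * (y ^ (N - 2))⁻¹ := by
  let z : ℍ := ⟨y * Complex.I, by simpa using hy⟩
  have hexp : Complex.exp (2 * Real.pi * Complex.I * z) = (Real.exp (-2 * Real.pi * y) : ℝ) := by
    rw [Complex.ofReal_exp]
    congr 1
    simp only [z]
    push_cast
    linear_combination (2 * Real.pi * y) * Complex.I_sq
  have h := congrArg norm (tsum_translate_pow_inv hN z)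
  rw [hexp] at h
  have e : ∑' n : ℕ, (n : ℂ) ^ (N - 1) * ((Real.exp (-2 * Real.pi * y) : ℝ) : ℂ) ^ n =
      ((∑' n : ℕ, (n : ℝ) ^ (N - 1) * Real.exp (-2 * Real.pi * y) ^ n : ℝ) : ℂ) := by
    rw [Complex.ofReal_tsum]
    push_cast
    rfl
  rw [e, norm_mul, Complex.norm_real, Real.norm_of_nonneg (tsum_nonneg fun n => by positivity)] at h
  have hc : ‖(-2 * Real.pi * Complex.I) ^ N / ((N - 1).factorial : ℂ)‖ =
      (2 * Real.pi) ^ N / (N - 1).factorial := by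
    simp [abs_of_pos Real.pi_pos]
  rw [hc] at h
  rw [← h]
  have hsum : Summable fun t : ℤ => ‖((y * Complex.I + t : ℂ) ^ 2)⁻¹‖ := by
    obtain ⟨K, hK, hb⟩ := exists_norm_pow_inv_translate_le le_rfl (X := |(z : ℂ).re|) z.im_pos
    exact Summable.of_nonneg_of_le (fun _ => norm_nonneg _) (hb z le_rfl le_rfl)
      (summable_one_add_int_sq_inv.mul_left K)
  refine tsum_of_norm_bounded (hsum.hasSum.mul_right _) fun t => ?_
  have h1 : y ≤ ‖(y * Complex.I + t : ℂ)‖ := by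
    refine (le_abs_self _).trans ?_
    simpa using Complex.abs_im_le_norm (y * Complex.I + t : ℂ)
  change ‖((y * Complex.I + t : ℂ) ^ N)⁻¹‖ ≤ _
  rw [← Nat.sub_add_cancel hN, pow_add, mul_inv, norm_mul, mul_comm, Nat.add_sub_cancel]
  refine mul_le_mul_of_nonneg_left ?_ (norm_nonneg _)
  rw [norm_inv, norm_pow]
  gcongr

/-- Summing norms over `n` first leaves a multiple of the binomial series at `|r| / im z < 1`. -/
lemma summable_doublePoleTerm {k : ℕ} (hk : 2 ≤ k) (β : ℂ) (r : ℝ) {z : ℍ} (hr : |r| < z.im) :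
    Summable (Function.uncurry
      (doublePoleTerm k β r (Complex.exp (2 * Real.pi * Complex.I * z)))) := by
  set q := Complex.exp (2 * Real.pi * Complex.I * z) with hq
  have hqn : ‖q‖ = Real.exp (-2 * Real.pi * z.im) := by
    simpa using norm_exp_two_pi_int_mul 1 (z : ℂ)
  have hz := z.im_pos
  have hn : ∀ j n, ‖doublePoleTerm k β r q j n‖ = ‖Ring.choose (-β) j‖ * |r| ^ j *
      ((2 * Real.pi) ^ (k + j) / (k + j - 1).factorial *
        ((n : ℝ) ^ (k + j - 1) * Real.exp (-2 * Real.pi * z.im) ^ n)) := by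
    intro j n
    simp only [doublePoleTerm, norm_mul, norm_pow, hqn]
    simp [abs_of_pos Real.pi_pos]
  refine Summable.of_norm ((summable_prod_of_nonneg fun p => norm_nonneg _).2 ⟨fun j => ?_, ?_⟩)
  · have h := ((summable_pow_mul_exp_pow (k + j - 1) z).mul_left
      ((-2 * Real.pi * Complex.I) ^ (k + j) / ((k + j - 1).factorial : ℂ))).mul_left
        (Ring.choose (-β) j * (r : ℂ) ^ j)
    refine h.norm.congr fun n => ?_
    rw [Function.uncurry_apply_pair, doublePoleTerm]
  · set T := ∑' t : ℤ, ‖((z.im * Complex.I + t : ℂ) ^ 2)⁻¹‖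
    refine Summable.of_nonneg_of_le (fun j => tsum_nonneg fun n => norm_nonneg _) (fun j => ?_)
      ((summable_norm_choose_mul_pow (-β) (ρ := |r| / z.im) (by positivity)
        ((div_lt_one hz).2 hr)).mul_right (T * (z.im ^ (k - 2))⁻¹))
    simp only [Function.uncurry_apply_pair]
    simp_rw [hn]
    rw [tsum_mul_left, tsum_mul_left, div_pow]
    refine (mul_le_mul_of_nonneg_left (tsum_pow_mul_exp_pow_le (by omega) hz)
      (by positivity)).trans_eq ?_
    rw [show k + j - 2 = (k - 2) + j by omega, pow_add, mul_inv, div_eq_mul_inv]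
    ring

/-- Expand binomially, exchange the translates `t` with `j`, apply Lipschitz's formula for each `j`,
then exchange `j` with the frequency `n`. -/
lemma hasSum_periodizedDoublePole_of_lt_im {k : ℕ} (hk : 2 ≤ k) (β : ℂ) (r : ℝ) {z : ℍ}
    (hr : |r| < z.im) :
    HasSum (fun n : ℕ => doublePoleCoeff k β r n * Complex.exp (2 * Real.pi * Complex.I * z) ^ n)
      (periodizedDoublePole k β r z) := by
  have hz := z.im_pos
  have hle : ∀ t : ℤ, z.im ≤ ‖(z + t : ℂ)‖ := fun t => by
    refine (le_abs_self _).trans ?_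
    simpa using Complex.abs_im_le_norm (z + t : ℂ)
  set f : ℤ → ℕ → ℂ := fun t j =>
    Ring.choose (-β) j * (r : ℂ) ^ j * (((z : ℂ) + t) ^ (k + j))⁻¹ with hf
  have hf1 : ∀ t, HasSum (f t) (doublePole k β r (z + t)) := by
    intro t
    have hlt : ‖(r : ℂ) / (z + t)‖ < 1 := by
      rw [norm_div, Complex.norm_real, div_lt_one (hz.trans_le (hle t))]
      exact hr.trans_le (hle t)
    refine ((hasSum_one_add_cpow (-β) hlt).mul_left (((z : ℂ) + t) ^ k)⁻¹).congr_fun ?_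
    intro j
    simp only [hf]
    rw [div_pow, pow_add, mul_inv]
    ring
  have hf2 : Summable (Function.uncurry f) := by
    obtain ⟨K, hK, hb⟩ := exists_norm_pow_inv_translate_le hk (X := |(z : ℂ).re|) hz
    have hs := ((summable_one_add_int_sq_inv.mul_left K).mul_of_nonneg
      (summable_norm_choose_mul_pow (-β) (ρ := |r| / z.im) (by positivity) ((div_lt_one hz).2 hr))
      (fun t => by positivity) (fun j => by positivity))
    refine Summable.of_norm_bounded hs fun ⟨t, j⟩ => ?_
    simp only [Function.uncurry_apply_pair, hf]
    rw [pow_add, mul_inv, norm_mul, norm_mul, norm_mul, mul_left_comm]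
    refine mul_le_mul (hb z le_rfl le_rfl t) ?_ (by positivity) (by positivity)
    rw [norm_pow, Complex.norm_real, Real.norm_eq_abs, norm_inv, norm_pow, mul_assoc, div_pow,
      div_eq_mul_inv]
    gcongr
    exact hle t
  set q := Complex.exp (2 * Real.pi * Complex.I * z) with hq
  have hg := summable_doublePoleTerm hk β r hr
  have hrow : ∀ j, ∑' t, f t j = ∑' n, doublePoleTerm k β r q j n := by
    intro j
    simp only [hf, doublePoleTerm]
    rw [tsum_mul_left, tsum_mul_left, tsum_mul_left, tsum_translate_pow_inv (by omega)]
  have e1 : periodizedDoublePole k β r z = ∑' n, ∑' j, doublePoleTerm k β r q j n := by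
    rw [hg.tsum_comm]
    rw [← tsum_congr hrow, hf2.tsum_comm]
    exact tsum_congr fun t => ((hf1 t).tsum_eq).symm
  simp_rw [tsum_doublePoleTerm_eq_coeff (by omega : 1 ≤ k)] at e1
  rw [e1]
  refine Summable.hasSum ?_
  have := hg.prod_symm.prod
  refine this.congr fun n => ?_
  exact tsum_doublePoleTerm_eq_coeff (by omega : 1 ≤ k) β r q n

/-- The binomial argument needs `|r| < im z`. At other heights the expansion exists because the
function is holomorphic, periodic and bounded at `i∞`; its coefficients are read off on the line of
height `|r| + 1`. -/
lemma hasSum_periodizedDoublePole {k : ℕ} (hk : 2 ≤ k) (β : ℂ) (r : ℝ) (z : ℍ) :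
    HasSum (fun n : ℕ => doublePoleCoeff k β r n *
      Complex.exp (2 * Real.pi * Complex.I * (n : ℤ) * z)) (periodizedDoublePole k β r z) := by
  set a : ℕ → ℂ := fun n =>
    (UpperHalfPlane.qExpansion 1 (periodizedDoublePole k β r)).coeff n with ha
  have hexp (n : ℕ) (w : ℂ) : Complex.exp (2 * Real.pi * Complex.I * w) ^ n =
      Complex.exp (2 * Real.pi * Complex.I * (n : ℤ) * w) := by
    rw [← Complex.exp_nat_mul]
    congr 1
    push_cast
    ring
  have hq : ∀ τ : ℍ, HasSum (fun n : ℕ => a n *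
      Complex.exp (2 * Real.pi * Complex.I * (n : ℤ) * τ)) (periodizedDoublePole k β r τ) := by
    intro τ
    have := UpperHalfPlane.hasSum_qExpansion one_pos (periodic_periodizedDoublePole k β r)
      (mdifferentiable_periodizedDoublePole hk β r)
      (isBoundedAtImInfty_periodizedDoublePole hk β r) τ
    refine this.congr_fun fun n => ?_
    rw [smul_eq_mul, Function.Periodic.qParam, Complex.ofReal_one, div_one, hexp]
  have hcoeff : a = doublePoleCoeff k β r := by
    funext n
    have hy : 0 < |r| + 1 := by positivity
    let p : ℝ → ℍ := fun u => ⟨u + (|r| + 1 : ℝ) * Complex.I, by simpa using hy⟩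
    have hA : ∀ u : ℝ, HasSum (fun n : ℕ => doublePoleCoeff k β r n *
        Complex.exp (2 * Real.pi * Complex.I * (n : ℤ) * (u + (|r| + 1 : ℝ) * Complex.I)))
        (periodizedDoublePole k β r (p u)) := by
      intro u
      have := hasSum_periodizedDoublePole_of_lt_im hk β r (z := p u)
        (by simp [p, ← UpperHalfPlane.coe_im])
      simpa only [hexp] using this
    exact (integral_exp_mul_eq_of_hasSum (ν := fun n : ℕ => (n : ℤ)) Nat.cast_injective
      (fun u => hq (p u)) n).symm.trans (integral_exp_mul_eq_of_hasSum
        (ν := fun n : ℕ => (n : ℤ)) Nat.cast_injective hA n)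
  rw [← hcoeff]
  exact hq z

/-- Exponential expansions of the members of a locally uniformly summable family add up to an
expansion of the sum. -/
lemma hasSum_exp_tsum {ι : Type*} {f : ι → ℍ → ℂ} {A : ι → ℕ → ℂ}
    (hf : ∀ i, ∀ z : ℍ, HasSum
      (fun n : ℕ => A i n * Complex.exp (2 * Real.pi * Complex.I * (n : ℤ) * (z : ℂ))) (f i z))
    (hU : ∀ y : ℝ, 0 < y → ∃ U : ι → ℝ, Summable U ∧
      ∀ i, ∀ z : ℍ, z.im = y → z.re ∈ Set.Icc (0 : ℝ) 1 → ‖f i z‖ ≤ U i) :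
    (∀ n, Summable fun i => A i n) ∧ ∀ z : ℍ, HasSum
      (fun n : ℕ => (∑' i, A i n) * Complex.exp (2 * Real.pi * Complex.I * (n : ℤ) * (z : ℂ)))
        (∑' i, f i z) := by
  have hA : ∀ y : ℝ, 0 < y → ∃ U : ι → ℝ, Summable U ∧
      ∀ i n, ‖A i n‖ ≤ Real.exp (2 * Real.pi * (n : ℤ) * y) * U i := by
    intro y hy
    obtain ⟨U, hU, hb⟩ := hU y hy
    refine ⟨U, hU, fun i n => ?_⟩
    let p : ℝ → ℍ := fun u => ⟨u + y * Complex.I, by simpa using hy⟩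
    exact norm_le_of_hasSum_exp (ν := fun n : ℕ => (n : ℤ)) Nat.cast_injective
      (g := fun u => f i (p u)) (fun u => hf i (p u))
      (fun u hu => hb i (p u) (by simp [p, ← UpperHalfPlane.coe_im])
        (by simpa [p, ← UpperHalfPlane.coe_re] using hu)) n
  refine ⟨fun n => ?_, fun z => ?_⟩
  · obtain ⟨U, hU, hb⟩ := hA 1 one_pos
    exact Summable.of_norm_bounded (hU.mul_left _) fun i => hb i n
  · have hz := z.im_pos
    -- Cauchy's estimate at half the height leaves the geometric factor `exp(-π n im z)`, which
    -- makes the double series converge absolutely.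
    obtain ⟨U, hUs, hb⟩ := hA (z.im / 2) (half_pos hz)
    set x := Real.exp (-(Real.pi * z.im)) with hx
    have hx1 : x < 1 := Real.exp_lt_one_iff.2 (by have := Real.pi_pos; nlinarith [mul_pos this hz])
    have hgeo : Summable fun n : ℕ => x ^ n := summable_geometric_of_lt_one (Real.exp_nonneg _) hx1
    have hU0 : ∀ i, 0 ≤ U i := fun i => by
      have := (norm_nonneg _).trans (hb i 0)
      simpa using this
    set F : ι → ℕ → ℂ := fun i n =>
      A i n * Complex.exp (2 * Real.pi * Complex.I * (n : ℤ) * (z : ℂ)) with hF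
    have hsum : Summable (Function.uncurry F) := by
      refine Summable.of_norm_bounded (hUs.mul_of_nonneg hgeo hU0 fun n => by positivity)
        fun ⟨i, n⟩ => ?_
      simp only [Function.uncurry_apply_pair, hF]
      rw [norm_mul, norm_exp_two_pi_int_mul]
      refine (mul_le_mul_of_nonneg_right (hb i n) (Real.exp_nonneg _)).trans_eq ?_
      rw [mul_right_comm, ← Real.exp_add, mul_comm, hx, ← Real.exp_nat_mul]
      congr 2
      push_cast
      simp only [UpperHalfPlane.coe_im]
      ring
    have e1 : ∑' i, f i z = ∑' n, ∑' i, F i n := by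
      rw [hsum.tsum_comm]
      exact tsum_congr fun i => (hf i z).tsum_eq.symm
    rw [e1]
    simp_rw [← tsum_mul_right]
    exact hsum.prod_symm.prod.hasSum

/-! ### The slashed power function -/

/-- The exponent `-k/2 + 2πim/ℓ` of the hyperbolic Poincaré series. -/
def hypExponent (k : ℕ) (ℓ : ℝ) (m : ℤ) : ℂ := -(k : ℂ) / 2 + 2 * Real.pi * Complex.I * m / ℓ

/-- The power function `w ↦ w ^ hypExponent k ℓ m` slashed by `M` in weight `k`. -/
def hypSlash (k : ℕ) (ℓ : ℝ) (m : ℤ) (M : SL(2, ℝ)) : ℍ → ℂ :=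
  (fun w : ℍ => (w : ℂ) ^ hypExponent k ℓ m) ∣[(k : ℤ)] glOf M

lemma slash_glOf_apply (k : ℕ) (f : ℍ → ℂ) (M : SL(2, ℝ)) (z : ℍ) :
    (f ∣[(k : ℤ)] glOf M) z = f (M • z) * ((M 1 0 * z + M 1 1 : ℂ) ^ k)⁻¹ := by
  have hσ : UpperHalfPlane.σ (glOf M) = ContinuousAlgEquiv.refl ℝ ℂ := by
    simp [UpperHalfPlane.σ]
  rw [ModularForm.slash_apply, hσ]
  simp only [UpperHalfPlane.denom, zpow_neg, zpow_natCast]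
  simp
  exact Or.inl rfl

lemma hypSlash_apply (k : ℕ) (ℓ : ℝ) (m : ℤ) (M : SL(2, ℝ)) (z : ℍ) :
    hypSlash k ℓ m M z = ((M 0 0 * z + M 0 1 : ℂ) / (M 1 0 * z + M 1 1)) ^ hypExponent k ℓ m *
      ((M 1 0 * z + M 1 1 : ℂ) ^ k)⁻¹ := by
  rw [hypSlash, slash_glOf_apply, coe_SL2_smul]

lemma hypSlash_slash (k : ℕ) (ℓ : ℝ) (m : ℤ) (M N : SL(2, ℝ)) :
    hypSlash k ℓ m M ∣[(k : ℤ)] glOf N = hypSlash k ℓ m (M * N) := by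
  rw [hypSlash, hypSlash, glOf, glOf, glOf, map_mul, SlashAction.slash_mul]

lemma hypSlash_neg {k : ℕ} (hk : Even k) (ℓ : ℝ) (m : ℤ) (M : SL(2, ℝ)) :
    hypSlash k ℓ m (-M) = hypSlash k ℓ m M := by
  funext z
  rw [hypSlash_apply, hypSlash_apply]
  have e (i : Fin 2) : ((-M) i 0 * z + (-M) i 1 : ℂ) = -(M i 0 * z + M i 1) := by
    simp
    ring
  rw [e, e, neg_div_neg_eq, hk.neg_pow]

/-- The matrix `diag(eˢ, e⁻ˢ)`. -/
def dilation (s : ℝ) : SL(2, ℝ) :=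
  ⟨!![Real.exp s, 0; 0, Real.exp (-s)], by simp [Matrix.det_fin_two, ← Real.exp_add]⟩

/-- The matrix `(1 x; 0 1)`. -/
def translation (x : ℝ) : SL(2, ℝ) := ⟨!![1, x; 0, 1], by simp [Matrix.det_fin_two]⟩

lemma coe_dilation (s : ℝ) :
    (dilation s : Matrix (Fin 2) (Fin 2) ℝ) = !![Real.exp s, 0; 0, Real.exp (-s)] := rfl

lemma coe_translation (x : ℝ) :
    (translation x : Matrix (Fin 2) (Fin 2) ℝ) = !![1, x; 0, 1] := rfl

lemma coe_dilation_mul (s : ℝ) (M : SL(2, ℝ)) :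
    ((dilation s * M : SL(2, ℝ)) : Matrix (Fin 2) (Fin 2) ℝ) =
      !![Real.exp s * M 0 0, Real.exp s * M 0 1; Real.exp (-s) * M 1 0, Real.exp (-s) * M 1 1] := by
  rw [Matrix.SpecialLinearGroup.coe_mul, coe_dilation, Matrix.eta_fin_two M.val,
    Matrix.mul_fin_two]
  simp

lemma coe_mul_translation (M : SL(2, ℝ)) (x : ℝ) :
    ((M * translation x : SL(2, ℝ)) : Matrix (Fin 2) (Fin 2) ℝ) =
      !![M 0 0, M 0 1 + x * M 0 0; M 1 0, M 1 1 + x * M 1 0] := by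
  rw [Matrix.SpecialLinearGroup.coe_mul, coe_translation, Matrix.eta_fin_two M.val,
    Matrix.mul_fin_two]
  simp [add_comm, mul_comm]

lemma hypSlash_mul_translation (k : ℕ) (ℓ : ℝ) (m : ℤ) (M : SL(2, ℝ)) (x : ℝ) {z w : ℍ}
    (h : (w : ℂ) = z + x) :
    hypSlash k ℓ m (M * translation x) z = hypSlash k ℓ m M w := by
  rw [hypSlash_apply, hypSlash_apply, coe_mul_translation, h]
  simp only [Matrix.of_apply, Matrix.cons_val', Matrix.cons_val_zero, Matrix.cons_val_one,
    Matrix.cons_val_fin_one]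
  push_cast
  congr 2 <;> ring_nf

lemma ofReal_mul_cpow_of_pos {x : ℝ} (hx : 0 < x) {w : ℂ} (hw : w ≠ 0) (p : ℂ) :
    ((x : ℂ) * w) ^ p = (x : ℂ) ^ p * w ^ p := by
  have hx0 : (x : ℂ) ≠ 0 := by exact_mod_cast hx.ne'
  rw [Complex.cpow_def_of_ne_zero (mul_ne_zero hx0 hw), Complex.cpow_def_of_ne_zero hx0,
    Complex.cpow_def_of_ne_zero hw, Complex.log_ofReal_mul hx hw, Complex.ofReal_log hx.le,
    add_mul, Complex.exp_add]

lemma SL2_num_ne_zero (M : SL(2, ℝ)) (z : ℍ) : (M 0 0 * z + M 0 1 : ℂ) ≠ 0 := fun h0 => by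
  have h := (M • z).im_pos
  rw [← UpperHalfPlane.coe_im, coe_SL2_smul] at h
  simp [h0] at h

lemma hypSlash_dilation_mul (k : ℕ) {ℓ : ℝ} (hℓ : 0 < ℓ) (m : ℤ) (t : ℤ) (M : SL(2, ℝ)) :
    hypSlash k ℓ m (dilation (t * ℓ / 2) * M) = hypSlash k ℓ m M := by
  funext z
  rw [hypSlash_apply, hypSlash_apply, coe_dilation_mul]
  simp only [Matrix.of_apply, Matrix.cons_val', Matrix.cons_val_zero, Matrix.cons_val_one,
    Matrix.cons_val_fin_one]
  set s : ℝ := t * ℓ / 2 with hs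
  have hd := SL2_denom_ne_zero M z
  have e1 : (((Real.exp s * M 0 0 : ℝ) : ℂ) * z + ((Real.exp s * M 0 1 : ℝ) : ℂ)) /
      (((Real.exp (-s) * M 1 0 : ℝ) : ℂ) * z + ((Real.exp (-s) * M 1 1 : ℝ) : ℂ)) =
      (Real.exp (t * ℓ) : ℝ) * ((M 0 0 * z + M 0 1 : ℂ) / (M 1 0 * z + M 1 1)) := by
    have : Real.exp (t * ℓ) = Real.exp s * Real.exp s := by
      rw [← Real.exp_add]
      congr 1
      rw [hs]
      ring
    rw [this, Real.exp_neg]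
    have h0 : ((Real.exp s : ℝ) : ℂ) ≠ 0 := by exact_mod_cast (Real.exp_pos s).ne'
    push_cast at h0 ⊢
    rw [← mul_div_assoc, div_eq_div_iff ?_ hd]
    · field_simp
    · rw [mul_assoc, ← mul_add]
      exact mul_ne_zero (inv_ne_zero h0) hd
  have e2 : ((Real.exp (-s) * M 1 0 : ℝ) : ℂ) * z + ((Real.exp (-s) * M 1 1 : ℝ) : ℂ) =
      (Real.exp (-s) : ℝ) * (M 1 0 * z + M 1 1 : ℂ) := by
    push_cast
    ring
  rw [e1, e2, ofReal_mul_cpow_of_pos (Real.exp_pos _) (div_ne_zero (SL2_num_ne_zero M z) hd),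
    mul_pow, mul_inv]
  have e3 : ((Real.exp (t * ℓ) : ℝ) : ℂ) ^ hypExponent k ℓ m *
      (((Real.exp (-s) : ℝ) : ℂ) ^ k)⁻¹ = 1 := by
    rw [Complex.cpow_def_of_ne_zero (by exact_mod_cast (Real.exp_pos _).ne'),
      ← Complex.ofReal_log (Real.exp_nonneg _), Real.log_exp, ← inv_pow, ← Complex.ofReal_inv,
      ← Real.exp_neg, neg_neg, Complex.ofReal_exp, ← Complex.exp_nat_mul, ← Complex.exp_add,
      Complex.exp_eq_one_iff]
    -- The real part `-k/2` of the exponent cancels the automorphy factor; the imaginary part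
    -- contributes `exp(2πi t m) = 1`.
    refine ⟨t * m, ?_⟩
    have : (ℓ : ℂ) ≠ 0 := by exact_mod_cast hℓ.ne'
    rw [hypExponent, hs]
    push_cast
    field_simp
    ring
  linear_combination (((M 0 0 * z + M 0 1 : ℂ) / (M 1 0 * z + M 1 1)) ^ hypExponent k ℓ m *
    ((M 1 0 * z + M 1 1 : ℂ) ^ k)⁻¹) * e3

/-- The product `(a² + b²)(c² + d²)` attached to a matrix `(a b; c d)`. -/
def rowNormProd (M : SL(2, ℝ)) : ℝ := (M 0 0 ^ 2 + M 0 1 ^ 2) * (M 1 0 ^ 2 + M 1 1 ^ 2)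

/-- Lagrange's identity: the product equals `(ac + bd)² + (ad - bc)²`. -/
lemma one_le_rowNormProd (M : SL(2, ℝ)) : 1 ≤ rowNormProd M := by
  have h := SL2_det_eq_one M
  unfold rowNormProd
  have : (M 0 0 * M 1 1 - M 0 1 * M 1 0) ^ 2 = 1 := by rw [h]; norm_num
  nlinarith [sq_nonneg (M 0 0 * M 1 0 + M 0 1 * M 1 1)]

lemma rowNormProd_neg (M : SL(2, ℝ)) : rowNormProd (-M) = rowNormProd M := by
  simp [rowNormProd]

lemma rowNormProd_dilation_mul (s : ℝ) (M : SL(2, ℝ)) :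
    rowNormProd (dilation s * M) = rowNormProd M := by
  have h : Real.exp s * Real.exp (-s) = 1 := by rw [← Real.exp_add]; simp
  simp only [rowNormProd, coe_dilation_mul]
  simp only [Matrix.of_apply, Matrix.cons_val', Matrix.cons_val_zero, Matrix.cons_val_one,
    Matrix.cons_val_fin_one]
  linear_combination ((M 0 0 ^ 2 + M 0 1 ^ 2) * (M 1 0 ^ 2 + M 1 1 ^ 2) *
    (Real.exp s * Real.exp (-s) + 1)) * h

/-- A lower bound for the smallest value of `‖a z + b‖ ^ 2` on the circle `a ^ 2 + b ^ 2 = 1`. -/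
def minRatio (z : ℂ) : ℝ := z.im ^ 2 / (‖z‖ ^ 2 + 1)

lemma hypExponent_re (k : ℕ) (ℓ : ℝ) (m : ℤ) : (hypExponent k ℓ m).re = -(k : ℝ) / 2 := by
  have : hypExponent k ℓ m = ((-(k : ℝ) / 2 : ℝ) : ℂ) + ((2 * Real.pi * m / ℓ : ℝ) : ℂ) * Complex.I := by
    rw [hypExponent]
    push_cast
    ring
  rw [this]
  simp

lemma hypExponent_im (k : ℕ) (ℓ : ℝ) (m : ℤ) : (hypExponent k ℓ m).im = 2 * Real.pi * m / ℓ := by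
  have : hypExponent k ℓ m = ((-(k : ℝ) / 2 : ℝ) : ℂ) + ((2 * Real.pi * m / ℓ : ℝ) : ℂ) * Complex.I := by
    rw [hypExponent]
    push_cast
    ring
  rw [this]
  simp

/-- In weight `2k` the modulus is `(|az + b| |cz + d|)⁻ᵏ` up to a bounded factor from the argument.
Two of the `k` powers give the row product; the others only need its lower bound `1`. -/
lemma norm_hypSlash_le {k : ℕ} (hk : 2 ≤ k) (ℓ : ℝ) (m : ℤ) (M : SL(2, ℝ)) (z : ℍ) :
    ‖hypSlash (k + k) ℓ m M z‖ ≤ Real.exp (Real.pi * |2 * Real.pi * m / ℓ|) *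
      (minRatio z ^ k)⁻¹ * (rowNormProd M)⁻¹ := by
  have hz := z.im_pos
  have hd : 0 < ‖(M 1 0 * z + M 1 1 : ℂ)‖ := norm_pos_iff.2 (SL2_denom_ne_zero M z)
  have hn : 0 < ‖(M 0 0 * z + M 0 1 : ℂ)‖ := norm_pos_iff.2 (SL2_num_ne_zero M z)
  set D := ‖(M 1 0 * z + M 1 1 : ℂ)‖ with hD
  set N := ‖(M 0 0 * z + M 0 1 : ℂ)‖ with hN
  have hκ : 0 < minRatio z := by
    unfold minRatio
    simp only [UpperHalfPlane.coe_im]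
    positivity
  have hrow (i : Fin 2) : minRatio z * (M i 0 ^ 2 + M i 1 ^ 2) ≤ ‖(M i 0 * z + M i 1 : ℂ)‖ ^ 2 := by
    rw [minRatio, div_mul_eq_mul_div, div_le_iff₀ (by positivity), mul_comm (‖_‖ ^ 2)]
    exact sq_add_sq_le_mul_normSq _ _ _
  have hX : minRatio z ^ 2 * rowNormProd M ≤ (N * D) ^ 2 := by
    rw [rowNormProd, mul_pow]
    calc _ = (minRatio z * (M 0 0 ^ 2 + M 0 1 ^ 2)) * (minRatio z * (M 1 0 ^ 2 + M 1 1 ^ 2)) := by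
          ring
      _ ≤ _ := mul_le_mul (hrow 0) (hrow 1) (by positivity) (by positivity)
  have hP := one_le_rowNormProd M
  have hXκ : minRatio z ≤ N * D := by
    refine le_of_sq_le_sq ?_ (by positivity)
    nlinarith [sq_nonneg (minRatio z)]
  have hXk : minRatio z ^ k * rowNormProd M ≤ (N * D) ^ k := by
    obtain ⟨j, rfl⟩ : ∃ j, k = j + 2 := ⟨k - 2, by omega⟩
    calc _ = minRatio z ^ j * (minRatio z ^ 2 * rowNormProd M) := by ring
      _ ≤ (N * D) ^ j * (N * D) ^ 2 := by gcongr
      _ = _ := by ring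
  rw [hypSlash_apply, norm_mul]
  have h1 : ‖((M 0 0 * z + M 0 1 : ℂ) / (M 1 0 * z + M 1 1)) ^ hypExponent (k + k) ℓ m‖ ≤
      ((N / D) ^ k)⁻¹ * Real.exp (Real.pi * |2 * Real.pi * m / ℓ|) := by
    refine (Complex.norm_cpow_le _ _).trans ?_
    rw [hypExponent_re, hypExponent_im, div_eq_mul_inv, ← Real.exp_neg, norm_div]
    have : (-((k + k : ℕ) : ℝ) / 2) = -((k : ℕ) : ℝ) := by push_cast; ring
    rw [this, Real.rpow_neg (by positivity), Real.rpow_natCast]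
    refine mul_le_mul_of_nonneg_left (Real.exp_le_exp.2 ((neg_le_abs _).trans ?_)) (by positivity)
    rw [abs_mul]
    exact mul_le_mul_of_nonneg_right (Complex.abs_arg_le_pi _) (abs_nonneg _)
  rw [norm_inv, norm_pow, ← hD]
  calc _ ≤ ((N / D) ^ k)⁻¹ * Real.exp (Real.pi * |2 * Real.pi * m / ℓ|) * (D ^ (k + k))⁻¹ :=
        mul_le_mul_of_nonneg_right h1 (by positivity)
    _ = Real.exp (Real.pi * |2 * Real.pi * m / ℓ|) * ((N * D) ^ k)⁻¹ := by
        rw [div_pow, mul_pow, pow_add]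
        field_simp
    _ ≤ Real.exp (Real.pi * |2 * Real.pi * m / ℓ|) * (minRatio z ^ k * rowNormProd M)⁻¹ := by
        gcongr
    _ = _ := by rw [mul_inv, ← mul_assoc]

/-- No branch is crossed: for `x < 0`, `arg x = π` and `arg (w / x) = arg w - π`, so the logarithms
add. -/
lemma cpow_eq_ofReal_cpow_mul_div_cpow {x : ℝ} (hx : x ≠ 0) {w : ℂ} (hw : 0 < w.im) (p : ℂ) :
    w ^ p = (x : ℂ) ^ p * (w / x) ^ p := by
  rcases lt_or_gt_of_ne hx with h | h
  · have hw0 := ne_zero_of_im_pos hw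
    have hx0 : (x : ℂ) ≠ 0 := by exact_mod_cast hx
    have hlog : Complex.log (w / x) = Complex.log w - Complex.log x := by
      have e : w / x = ((-x)⁻¹ : ℝ) * (-w) := by
        push_cast
        field_simp
      have hpos : 0 < (-x)⁻¹ := by
        rw [inv_pos]
        linarith
      rw [e, Complex.log_ofReal_mul hpos (neg_ne_zero.2 hw0), Complex.log, Complex.log, Complex.log,
        Complex.arg_neg_eq_arg_sub_pi_of_im_pos hw, Complex.arg_ofReal_of_neg h, Real.log_inv,
        norm_neg, Complex.norm_real, Real.norm_eq_abs, abs_of_neg h]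
      push_cast
      ring
    rw [Complex.cpow_def_of_ne_zero hw0, Complex.cpow_def_of_ne_zero hx0,
      Complex.cpow_def_of_ne_zero (div_ne_zero hw0 hx0), hlog, ← Complex.exp_add]
    congr 1
    ring
  · have hx0 : (x : ℂ) ≠ 0 := by exact_mod_cast hx
    rw [← ofReal_mul_cpow_of_pos h (div_ne_zero (ne_zero_of_im_pos hw) hx0)]
    congr 1
    field_simp

/-- The second upper parameter of the slashed power function. -/
def hypBeta (k : ℕ) (ℓ : ℝ) (m : ℤ) : ℂ := (k : ℂ) / 2 + 2 * Real.pi * Complex.I * m / ℓ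

lemma hypSlash_eq_doublePole {k : ℕ} (hk : Even k) (ℓ : ℝ) (m : ℤ) (M : SL(2, ℝ))
    (ha : M 0 0 ≠ 0) (hc : M 1 0 ≠ 0) (z : ℍ) :
    hypSlash k ℓ m M z =
      Complex.exp (2 * Real.pi * Complex.I *
        ((m : ℂ) / ℓ * Complex.log ((M 0 0 / M 1 0 : ℝ) : ℂ))) /
        ((M 0 0 * M 1 0 : ℝ) : ℂ) ^ (k / 2) *
      doublePole k (hypBeta k ℓ m) (M 0 0 * M 1 0)⁻¹ (z + (M 0 1 / M 0 0 : ℝ)) := by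
  have hac : M 0 0 / M 1 0 ≠ 0 := div_ne_zero ha hc
  have hdet := SL2_det_eq_one M
  set a := M 0 0
  set b := M 0 1
  set c := M 1 0
  set d := M 1 1
  have haC : (a : ℂ) ≠ 0 := by exact_mod_cast ha
  have hcC : (c : ℂ) ≠ 0 := by exact_mod_cast hc
  set w : ℂ := z + (b / a : ℝ) with hw
  have hwim : 0 < w.im := by
    have := z.im_pos
    simpa [hw] using this
  have hw0 := ne_zero_of_im_pos hwim
  set v : ℂ := 1 + ((a * c)⁻¹ : ℝ) / w with hv
  have hv0 : v ≠ 0 := Complex.slitPlane_ne_zero (one_add_div_mem_slitPlane _ hwim)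
  have hdetC : (a : ℂ) * d - b * c = 1 := by exact_mod_cast hdet
  have hden : (c * z + d : ℂ) = c * w * v := by
    rw [hv]
    have : (c * w * (1 + ((a * c)⁻¹ : ℝ) / w) : ℂ) = c * w + (a : ℂ)⁻¹ := by
      push_cast
      field_simp
    rw [this, hw]
    push_cast
    field_simp
    linear_combination hdetC
  have hnum : (a * z + b : ℂ) = a * w := by
    rw [hw]
    push_cast
    field_simp
  have hquot : (a * z + b : ℂ) / (c * z + d) = (a / c : ℝ) * v⁻¹ := by
    rw [hden, hnum]
    push_cast
    field_simp
  have him : 0 < ((a * z + b : ℂ) / (c * z + d)).im := by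
    have := (M • z).im_pos
    rwa [← UpperHalfPlane.coe_im, coe_SL2_smul] at this
  rw [hypSlash_apply, cpow_eq_ofReal_cpow_mul_div_cpow hac him]
  have e1 : (a * z + b : ℂ) / (c * z + d) / ((a / c : ℝ) : ℂ) = v⁻¹ := by
    rw [hquot]
    have : ((a / c : ℝ) : ℂ) ≠ 0 := by exact_mod_cast hac
    field_simp
  rw [e1, hden, doublePole, ← hv]
  -- Inverting `v` inside the power is legitimate because `v` avoids the branch cut.
  have e2 : v⁻¹ ^ hypExponent k ℓ m * (v ^ k)⁻¹ = v ^ (-hypBeta k ℓ m) := by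
    have harg : v.arg ≠ Real.pi := Complex.slitPlane_arg_ne_pi (one_add_div_mem_slitPlane _ hwim)
    rw [Complex.inv_cpow _ _ harg, ← Complex.cpow_neg, ← Complex.cpow_natCast, ← Complex.cpow_neg,
      ← Complex.cpow_add _ _ hv0]
    congr 1
    rw [hypExponent, hypBeta]
    ring
  have e3 : ((a / c : ℝ) : ℂ) ^ hypExponent k ℓ m = Complex.exp (2 * Real.pi * Complex.I *
        ((m : ℂ) / ℓ * Complex.log ((a / c : ℝ) : ℂ))) * (((a / c : ℝ) : ℂ) ^ (k / 2))⁻¹ := by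
    have h0 : ((a / c : ℝ) : ℂ) ≠ 0 := by exact_mod_cast hac
    have hk2 : ((k / 2 : ℕ) : ℂ) = (k : ℂ) / 2 := by
      rw [Nat.cast_div hk.two_dvd (by norm_num)]
      norm_num
    rw [← Complex.cpow_natCast, hk2, ← Complex.cpow_neg, Complex.cpow_def_of_ne_zero h0,
      Complex.cpow_def_of_ne_zero h0, ← Complex.exp_add, hypExponent]
    congr 1
    ring
  have e4 : (((a / c : ℝ) : ℂ) ^ (k / 2))⁻¹ * ((c : ℂ) ^ k)⁻¹ =
      (((a * c : ℝ) : ℂ) ^ (k / 2))⁻¹ := by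
    obtain ⟨j, rfl⟩ := hk
    rw [show (j + j) / 2 = j by omega]
    push_cast
    rw [div_pow, mul_pow, pow_add]
    field_simp
  rw [e3, mul_pow, mul_pow, mul_inv, mul_inv, ← e2, div_eq_mul_inv (Complex.exp _), ← e4]
  ring

/-! ### Norms under dilation -/

lemma sqNorm_neg (g : SL(2, ℝ)) : sqNorm (-g) = sqNorm g := by simp [sqNorm]

lemma SL2_inv_neg (g : SL(2, ℝ)) : (-g)⁻¹ = -g⁻¹ := by
  rw [inv_eq_iff_mul_eq_one, neg_mul_neg, mul_inv_cancel]

lemma exp_mul_two (x : ℝ) : Real.exp (x * 2) = Real.exp x ^ 2 := by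
  rw [← Real.exp_nat_mul]
  congr 1
  push_cast
  ring

lemma sqNorm_dilation_mul (s : ℝ) (M : SL(2, ℝ)) :
    sqNorm (dilation s * M) = Real.exp (s * 2) * (M 0 0 ^ 2 + M 0 1 ^ 2) +
      Real.exp (-s * 2) * (M 1 0 ^ 2 + M 1 1 ^ 2) := by
  rw [exp_mul_two, exp_mul_two, sqNorm, coe_dilation_mul]
  simp only [Matrix.of_apply, Matrix.cons_val', Matrix.cons_val_zero, Matrix.cons_val_one,
    Matrix.cons_val_fin_one]
  ring

lemma exists_int_balance {ℓ P Q : ℝ} (hℓ : 0 < ℓ) (hP : 0 < P) (hQ : 0 < Q) :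
    ∃ t : ℤ, (Real.exp (t * ℓ) * P + Real.exp (-(t * ℓ)) * Q) ^ 2 ≤
      4 * Real.exp (2 * ℓ) * (P * Q) := by
  obtain ⟨x, hx⟩ : ∃ x, P = Real.exp (2 * ℓ * x) * Q := by
    refine ⟨Real.log (P / Q) / (2 * ℓ), ?_⟩
    rw [mul_div_cancel₀ _ (by positivity), Real.exp_log (by positivity)]
    field_simp
  -- The two terms are equal at the real value `t = -x`; rounding costs a factor of at most `exp ℓ`
  -- in each.
  refine ⟨-⌊x⌋, ?_⟩
  have ht1 := Int.floor_le x
  have ht2 := (Int.lt_floor_add_one x).le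
  rw [hx]
  have e1 : Real.exp ((-⌊x⌋ : ℤ) * ℓ) * (Real.exp (2 * ℓ * x) * Q) =
      Real.exp (ℓ * x) * Real.exp (ℓ * (x - ⌊x⌋)) * Q := by
    rw [← mul_assoc, ← Real.exp_add, ← Real.exp_add]
    congr 2
    push_cast
    ring
  have e2 : Real.exp (-((-⌊x⌋ : ℤ) * ℓ)) = Real.exp (ℓ * x) * Real.exp (-(ℓ * (x - ⌊x⌋))) := by
    rw [← Real.exp_add]
    congr 1
    push_cast
    ring
  have e3 : Real.exp (2 * ℓ * x) = Real.exp (ℓ * x) ^ 2 := by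
    rw [← exp_mul_two]
    ring_nf
  have e4 : Real.exp (2 * ℓ) = Real.exp ℓ ^ 2 := by rw [← exp_mul_two, mul_comm]
  rw [e1, e2, e3, e4]
  have h1 : Real.exp (ℓ * (x - ⌊x⌋)) ≤ Real.exp ℓ := Real.exp_le_exp.2 (by nlinarith)
  have h2 : Real.exp (-(ℓ * (x - ⌊x⌋))) ≤ Real.exp ℓ := Real.exp_le_exp.2 (by nlinarith)
  calc _ ≤ (Real.exp (ℓ * x) * Real.exp ℓ * Q + Real.exp (ℓ * x) * Real.exp ℓ * Q) ^ 2 := by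
        gcongr
    _ = _ := by ring

/-- The conjugated translation is `(1 - ac, a²; -c², 1 + ac)`, triangular when `ac = 0`; the
dilation rescales only its off-diagonal entries, by `e^(∓2s)`. -/
lemma sqNorm_conj_translation (M : SL(2, ℝ)) (h : M 0 0 * M 1 0 = 0) (s : ℝ) :
    sqNorm ((dilation s)⁻¹ * (M * translation 1 * M⁻¹) * dilation s) =
      2 + Real.exp (-(4 * s)) * M 0 0 ^ 4 + Real.exp (4 * s) * M 1 0 ^ 4 := by
  have hdet := SL2_det_eq_one M
  have hs : Real.exp s * Real.exp (-s) = 1 := by rw [← Real.exp_add]; simp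
  have e1 : Real.exp (4 * s) = Real.exp s ^ 4 := by rw [← Real.exp_nat_mul]; simp
  have e2 : Real.exp (-(4 * s)) = Real.exp (-s) ^ 4 := by rw [← Real.exp_nat_mul]; simp
  have hmat : (((dilation s)⁻¹ * (M * translation 1 * M⁻¹) * dilation s : SL(2, ℝ)) :
      Matrix (Fin 2) (Fin 2) ℝ) =
      !![1, Real.exp (-s) ^ 2 * M 0 0 ^ 2; -(Real.exp s ^ 2 * M 1 0 ^ 2), 1] := by
    rw [Matrix.SpecialLinearGroup.coe_mul, Matrix.SpecialLinearGroup.coe_mul,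
      Matrix.SpecialLinearGroup.coe_mul, coe_mul_translation, Matrix.SpecialLinearGroup.coe_inv,
      Matrix.SpecialLinearGroup.coe_inv, Matrix.adjugate_fin_two, Matrix.adjugate_fin_two,
      coe_dilation, Matrix.mul_fin_two, Matrix.mul_fin_two, Matrix.mul_fin_two]
    simp only [Matrix.of_apply, Matrix.cons_val', Matrix.cons_val_zero, Matrix.cons_val_one,
      Matrix.cons_val_fin_one]
    congr 1
    ext i j
    fin_cases i <;> fin_cases j <;> simp
    · linear_combination (M 0 0 * M 1 1 - M 0 1 * M 1 0 - M 0 0 * M 1 0) * hs + hdet - h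
    · ring
    · ring
    · linear_combination (M 0 0 * M 1 1 - M 0 1 * M 1 0 + M 0 0 * M 1 0) * hs + hdet + h
  rw [sqNorm, hmat, e1, e2]
  simp only [Matrix.of_apply, Matrix.cons_val', Matrix.cons_val_zero, Matrix.cons_val_one,
    Matrix.cons_val_fin_one]
  ring

/-! ### Stabilizers, cosets and representatives -/

section Stabilizers

variable {Γ : Subgroup SL(2, ℝ)} {η₁ η₂ 𝔞 : OnePoint ℝ} {ση σa : SL(2, ℝ)} {ℓ : ℝ}

lemma SL2_eq_or_eq_neg_iff (g h : SL(2, ℝ)) :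
    ((g : Matrix (Fin 2) (Fin 2) ℝ) = h ∨ (g : Matrix (Fin 2) (Fin 2) ℝ) = -h) ↔
      g = h ∨ g = -h := by
  refine or_congr ⟨fun e => Subtype.ext e, fun e => by rw [e]⟩
    ⟨fun e => Subtype.ext (e.trans (Matrix.SpecialLinearGroup.coe_neg h).symm), fun e => ?_⟩
  rw [e, Matrix.SpecialLinearGroup.coe_neg]

lemma IsHyperbolicScaling.exists_eq_dilation (hσ : IsHyperbolicScaling Γ η₁ η₂ ση ℓ) {γ : Γ}
    (hγ : γ ∈ pairStab Γ η₁ η₂) : ∃ t : ℤ, ση⁻¹ * (γ : SL(2, ℝ)) * ση = dilation (t * ℓ / 2) ∨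
      ση⁻¹ * (γ : SL(2, ℝ)) * ση = -dilation (t * ℓ / 2) := by
  obtain ⟨t, ht⟩ := (hσ.conj (ση⁻¹ * (γ : SL(2, ℝ)) * ση)).1 ⟨γ, hγ, Or.inl rfl⟩
  exact ⟨t, (SL2_eq_or_eq_neg_iff _ _).1 ht⟩

lemma IsHyperbolicScaling.exists_mem_pairStab (hσ : IsHyperbolicScaling Γ η₁ η₂ ση ℓ) (t : ℤ) :
    ∃ γ ∈ pairStab Γ η₁ η₂, ση⁻¹ * (γ : SL(2, ℝ)) * ση = dilation (t * ℓ / 2) ∨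
      ση⁻¹ * (γ : SL(2, ℝ)) * ση = -dilation (t * ℓ / 2) := by
  obtain ⟨γ, hγ, h⟩ := (hσ.conj (dilation (t * ℓ / 2))).2
    ⟨t, (SL2_eq_or_eq_neg_iff _ (dilation (t * ℓ / 2))).2 (Or.inl rfl)⟩
  refine ⟨γ, hγ, h.imp Eq.symm fun h => ?_⟩
  rw [h, neg_neg]

lemma IsCuspScaling.exists_eq_translation (hσ : IsCuspScaling Γ 𝔞 σa) {γ : Γ}
    (hγ : γ ∈ cuspStab Γ 𝔞) : ∃ t : ℤ, σa⁻¹ * (γ : SL(2, ℝ)) * σa = translation t ∨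
      σa⁻¹ * (γ : SL(2, ℝ)) * σa = -translation t := by
  obtain ⟨t, ht⟩ := (hσ.conj (σa⁻¹ * (γ : SL(2, ℝ)) * σa)).1 ⟨γ, hγ, Or.inl rfl⟩
  exact ⟨t, (SL2_eq_or_eq_neg_iff _ (translation t)).1 ht⟩

lemma IsCuspScaling.exists_mem_cuspStab (hσ : IsCuspScaling Γ 𝔞 σa) (t : ℤ) :
    ∃ γ ∈ cuspStab Γ 𝔞, σa⁻¹ * (γ : SL(2, ℝ)) * σa = translation t ∨
      σa⁻¹ * (γ : SL(2, ℝ)) * σa = -translation t := by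
  obtain ⟨γ, hγ, h⟩ := (hσ.conj (translation t)).2
    ⟨t, (SL2_eq_or_eq_neg_iff _ (translation t)).2 (Or.inl rfl)⟩
  refine ⟨γ, hγ, h.imp Eq.symm fun h => ?_⟩
  rw [h, neg_neg]

lemma conj_mul_eq_or {σ τ h γ d : SL(2, ℝ)} (hd : σ⁻¹ * h * σ = d ∨ σ⁻¹ * h * σ = -d) :
    σ⁻¹ * (h * γ) * τ = d * (σ⁻¹ * γ * τ) ∨ σ⁻¹ * (h * γ) * τ = -(d * (σ⁻¹ * γ * τ)) := by
  have e : σ⁻¹ * (h * γ) * τ = (σ⁻¹ * h * σ) * (σ⁻¹ * γ * τ) := by group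
  rw [e]
  rcases hd with h | h
  · left; rw [h]
  · right; rw [h, neg_mul]

lemma mul_conj_eq_or {σ τ h γ d : SL(2, ℝ)} (hd : τ⁻¹ * h * τ = d ∨ τ⁻¹ * h * τ = -d) :
    σ⁻¹ * (γ * h) * τ = σ⁻¹ * γ * τ * d ∨ σ⁻¹ * (γ * h) * τ = -(σ⁻¹ * γ * τ * d) := by
  have e : σ⁻¹ * (γ * h) * τ = (σ⁻¹ * γ * τ) * (τ⁻¹ * h * τ) := by group
  rw [e]
  rcases hd with h | h
  · left; rw [h]
  · right; rw [h, mul_neg]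

/-- A function of the matrix that is even and invariant under the dilations takes the same value
at all representatives of a coset in `Γ_η \ Γ`. -/
lemma IsHyperbolicScaling.apply_eq_of_mk_eq {α : Type*} (hσ : IsHyperbolicScaling Γ η₁ η₂ ση ℓ)
    {F : SL(2, ℝ) → α} (hneg : ∀ M, F (-M) = F M)
    (hdil : ∀ (t : ℤ) M, F (dilation (t * ℓ / 2) * M) = F M) (τ : SL(2, ℝ)) {γ γ' : Γ}
    (h : (Quotient.mk _ γ : PairCosets Γ η₁ η₂) = Quotient.mk _ γ') :
    F (ση⁻¹ * γ * τ) = F (ση⁻¹ * γ' * τ) := by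
  have hmem := QuotientGroup.rightRel_apply.1 (Quotient.exact h)
  obtain ⟨t, ht⟩ := hσ.exists_eq_dilation hmem
  have e : (γ' : SL(2, ℝ)) = ((γ' * γ⁻¹ : Γ) : SL(2, ℝ)) * γ := by simp
  rw [e]
  rcases conj_mul_eq_or (τ := τ) (γ := (γ : SL(2, ℝ))) ht with h | h
  · rw [h, hdil]
  · rw [h, hneg, hdil]

lemma mk_mul_eq_of_mem_pairStab {h : Γ} (hh : h ∈ pairStab Γ η₁ η₂) (γ : Γ) :
    (Quotient.mk _ (h * γ) : PairCosets Γ η₁ η₂) = Quotient.mk _ γ := by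
  refine Quotient.sound (QuotientGroup.rightRel_apply.2 ?_)
  simpa using hh

/-- Moving within the coset stretches one row and shrinks the other, so the two lengths can be made
comparable. -/
lemma IsHyperbolicScaling.exists_balanced (hσ : IsHyperbolicScaling Γ η₁ η₂ ση ℓ) (τ : SL(2, ℝ))
    (γ : Γ) : ∃ γ' : Γ, (Quotient.mk _ γ' : PairCosets Γ η₁ η₂) = Quotient.mk _ γ ∧
      sqNorm (ση⁻¹ * γ' * τ) ^ 2 ≤ 4 * Real.exp (2 * ℓ) * rowNormProd (ση⁻¹ * γ * τ) := by
  obtain ⟨t, ht⟩ := exists_int_balance hσ.length_pos (num_sq_pos (ση⁻¹ * (γ : SL(2, ℝ)) * τ))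
    (denom_sq_pos (ση⁻¹ * (γ : SL(2, ℝ)) * τ))
  obtain ⟨h, hh, hd⟩ := hσ.exists_mem_pairStab t
  refine ⟨h * γ, mk_mul_eq_of_mem_pairStab hh γ, ?_⟩
  have key := sqNorm_dilation_mul (t * ℓ / 2) (ση⁻¹ * (γ : SL(2, ℝ)) * τ)
  rw [div_mul_cancel₀ _ two_ne_zero, neg_mul, div_mul_cancel₀ _ two_ne_zero] at key
  rw [← key] at ht
  rw [Subgroup.coe_mul]
  rcases conj_mul_eq_or (τ := τ) (γ := (γ : SL(2, ℝ))) hd with e | e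
  · rw [e]
    exact ht
  · rw [e, sqNorm_neg]
    exact ht

lemma summable_inv_rowNormProd [DiscreteTopology Γ] (hσ : IsHyperbolicScaling Γ η₁ η₂ ση ℓ)
    (τ : SL(2, ℝ)) : Summable fun q : PairCosets Γ η₁ η₂ =>
      (rowNormProd (ση⁻¹ * (q.out : Γ) * τ))⁻¹ := by
  choose rep hrep hle using fun q : PairCosets Γ η₁ η₂ => hσ.exists_balanced τ q.out
  -- Distinct cosets have distinct balanced representatives, so the sum over cosets is dominated by
  -- a subsum over `Γ`.
  have hinj : Function.Injective rep := fun q q' h => by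
    rw [← Quotient.out_eq q, ← Quotient.out_eq q', ← hrep q, ← hrep q', h]
  refine Summable.of_nonneg_of_le
    (fun q => inv_nonneg.2 (zero_le_one.trans (one_le_rowNormProd _))) (fun q => ?_)
    (((summable_inv_sqNorm_mul_mul_sq Γ ση⁻¹ τ).comp_injective hinj).mul_left
      (4 * Real.exp (2 * ℓ)))
  have h1 := sqNorm_pos (ση⁻¹ * (rep q : SL(2, ℝ)) * τ)
  have h2 := zero_lt_one.trans_le (one_le_rowNormProd (ση⁻¹ * (q.out : Γ) * τ))
  simp only [Function.comp_apply]
  rw [← div_eq_mul_inv, inv_eq_one_div, div_le_div_iff₀ h2 (by positivity), one_mul]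
  exact hle q

/-- If `ac = 0`, then `γ 𝔞` is `η₁` or `η₂`. Conjugating a parabolic element fixing it by powers of
a hyperbolic one contracts the parabolic part, giving infinitely many elements of bounded norm in a
discrete group. -/
lemma mul_ne_zero_of_scaling [DiscreteTopology Γ] (hη : IsHyperbolicScaling Γ η₁ η₂ ση ℓ)
    (ha : IsCuspScaling Γ 𝔞 σa) (γ : Γ) :
    (ση⁻¹ * (γ : SL(2, ℝ)) * σa) 0 0 * (ση⁻¹ * (γ : SL(2, ℝ)) * σa) 1 0 ≠ 0 := by
  intro h0
  have hℓ := hη.length_pos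
  obtain ⟨M, hM⟩ : ∃ M, M = ση⁻¹ * (γ : SL(2, ℝ)) * σa := ⟨_, rfl⟩
  rw [← hM] at h0
  have hdet := SL2_det_eq_one M
  obtain ⟨δ, -, hδ⟩ := ha.exists_mem_cuspStab 1
  rw [Int.cast_one] at hδ
  -- The sign `ε` selects the direction of dilation that shrinks the surviving off-diagonal entry.
  obtain ⟨ε, hε⟩ : ∃ ε : ℤ, (ε = 1 ∧ M 1 0 = 0) ∨ (ε = -1 ∧ M 0 0 = 0) := by
    rcases mul_eq_zero.1 h0 with h | h
    · exact ⟨-1, Or.inr ⟨rfl, h⟩⟩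
    · exact ⟨1, Or.inl ⟨rfl, h⟩⟩
  choose H hH hHd using fun n : ℕ => hη.exists_mem_pairStab (ε * n)
  -- conjugates of a parabolic element by powers of a hyperbolic one
  obtain ⟨y, hy⟩ : ∃ y : ℕ → Γ, ∀ n, y n = (H n)⁻¹ * (γ * δ * γ⁻¹) * H n := ⟨_, fun _ => rfl⟩
  have hval : ∀ n : ℕ, sqNorm (ση⁻¹ * (y n : SL(2, ℝ)) * ση) =
      2 + Real.exp (-(2 * n * ℓ)) * (M 0 0 ^ 4 + M 1 0 ^ 4) := by
    intro n
    have e : ση⁻¹ * (y n : SL(2, ℝ)) * ση = (ση⁻¹ * (H n : SL(2, ℝ)) * ση)⁻¹ *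
        (M * (σa⁻¹ * (δ : SL(2, ℝ)) * σa) * M⁻¹) * (ση⁻¹ * (H n : SL(2, ℝ)) * ση) := by
      simp only [hy, hM, Subgroup.coe_mul, Subgroup.coe_inv]
      group
    have key : sqNorm ((dilation ((ε * n : ℤ) * ℓ / 2))⁻¹ * (M * translation 1 * M⁻¹) *
        dilation ((ε * n : ℤ) * ℓ / 2)) =
          2 + Real.exp (-(2 * n * ℓ)) * (M 0 0 ^ 4 + M 1 0 ^ 4) := by
      rw [sqNorm_conj_translation M h0]
      rcases hε with ⟨rfl, h⟩ | ⟨rfl, h⟩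
      · rw [h]
        push_cast
        ring_nf
      · rw [h]
        push_cast
        ring_nf
    rw [e, ← key]
    rcases hHd n with h1 | h1 <;> rcases hδ with h2 | h2 <;> rw [h1, h2] <;>
      simp only [SL2_inv_neg, mul_neg, neg_mul, neg_neg, sqNorm_neg]
  have hpos : 0 < M 0 0 ^ 4 + M 1 0 ^ 4 := by
    rcases hε with ⟨-, h⟩ | ⟨-, h⟩
    · have : M 0 0 ≠ 0 := fun h' => by simp [h, h'] at hdet
      positivity
    · have : M 1 0 ≠ 0 := fun h' => by simp [h, h'] at hdet
      positivity
  have hinj : Function.Injective y := by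
    intro n n' h
    have h1 := hval n
    rw [h, hval n'] at h1
    have h2 : Real.exp (-(2 * n' * ℓ)) = Real.exp (-(2 * n * ℓ)) :=
      mul_right_cancel₀ hpos.ne' (by linarith)
    have h3 := Real.exp_injective h2
    have h4 : (n : ℝ) = n' := by
      have : (2 * ℓ) * (n : ℝ) = 2 * ℓ * n' := by linarith
      exact mul_left_cancel₀ (by positivity) this
    exact_mod_cast h4
  refine (Set.infinite_range_of_injective hinj) ((finite_sqNorm_le Γ
    (sqNorm ση * (2 + (M 0 0 ^ 4 + M 1 0 ^ 4)) * sqNorm ση)).subset ?_)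
  rintro _ ⟨n, rfl⟩
  have e : (y n : SL(2, ℝ)) = ση * (ση⁻¹ * (y n : SL(2, ℝ)) * ση) * ση⁻¹ := by group
  have h1 : sqNorm (ση⁻¹ * (y n : SL(2, ℝ)) * ση) ≤ 2 + (M 0 0 ^ 4 + M 1 0 ^ 4) := by
    rw [hval n]
    have : Real.exp (-(2 * n * ℓ)) ≤ 1 := Real.exp_le_one_iff.2 (by
      have : 0 ≤ 2 * n * ℓ := by positivity
      linarith)
    have := mul_le_mul_of_nonneg_right this hpos.le
    linarith
  have hs := sqNorm_nonneg ση
  rw [Set.mem_ofPred_eq, e]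
  refine (sqNorm_mul_le _ _).trans ?_
  rw [sqNorm_inv]
  exact mul_le_mul_of_nonneg_right ((sqNorm_mul_le _ _).trans
    (mul_le_mul_of_nonneg_left h1 hs)) hs

lemma left_ne_zero_of_scaling [DiscreteTopology Γ] (hη : IsHyperbolicScaling Γ η₁ η₂ ση ℓ)
    (ha : IsCuspScaling Γ 𝔞 σa) (γ : Γ) : (ση⁻¹ * (γ : SL(2, ℝ)) * σa) 0 0 ≠ 0 :=
  left_ne_zero_of_mul (mul_ne_zero_of_scaling hη ha γ)

lemma right_ne_zero_of_scaling [DiscreteTopology Γ] (hη : IsHyperbolicScaling Γ η₁ η₂ ση ℓ)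
    (ha : IsCuspScaling Γ 𝔞 σa) (γ : Γ) : (ση⁻¹ * (γ : SL(2, ℝ)) * σa) 1 0 ≠ 0 :=
  right_ne_zero_of_mul (mul_ne_zero_of_scaling hη ha γ)

/-- The elements of `Γ_𝔞` that act as translations by integers, up to signs. -/
def IsCuspScaling.shift (hσ : IsCuspScaling Γ 𝔞 σa) (t : ℤ) : Γ := (hσ.exists_mem_cuspStab t).choose

lemma IsCuspScaling.shift_mem (hσ : IsCuspScaling Γ 𝔞 σa) (t : ℤ) : hσ.shift t ∈ cuspStab Γ 𝔞 :=
  (hσ.exists_mem_cuspStab t).choose_spec.1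

lemma IsCuspScaling.conj_shift (hσ : IsCuspScaling Γ 𝔞 σa) (t : ℤ) :
    σa⁻¹ * (hσ.shift t : SL(2, ℝ)) * σa = translation t ∨
      σa⁻¹ * (hσ.shift t : SL(2, ℝ)) * σa = -translation t :=
  (hσ.exists_mem_cuspStab t).choose_spec.2

lemma mem_cuspStab_of_eq_one_or {γ : Γ} (h : (γ : SL(2, ℝ)) = 1 ∨ (γ : SL(2, ℝ)) = -1)
    (x : OnePoint ℝ) : γ ∈ cuspStab Γ x := by
  rw [cuspStab, Subgroup.mem_comap, MulAction.mem_stabilizer_iff]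
  change glOf (γ : SL(2, ℝ)) • x = x
  rcases h with h | h <;> rw [h]
  · simp [glOf]
  · cases x using OnePoint.rec with
    | infty => simp [OnePoint.smul_infty_eq_self_iff]
    | coe t => simp [OnePoint.smul_some_eq_ite]

/-- The coset of `γ δ`, for `γ` a representative of a double coset and `δ` an integral shift. -/
def cosetOfShift (hσ : IsCuspScaling Γ 𝔞 σa) (p : PairCuspCosets Γ η₁ η₂ 𝔞 × ℤ) :
    PairCosets Γ η₁ η₂ :=
  Quotient.mk _ ((Quotient.out p.1 : Γ) * hσ.shift p.2)

lemma cosetOfShift_surjective (ha : IsCuspScaling Γ 𝔞 σa) :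
    Function.Surjective (cosetOfShift (η₁ := η₁) (η₂ := η₂) ha) := by
  intro q
  obtain ⟨γ, rfl⟩ := Quotient.exists_rep q
  set D : PairCuspCosets Γ η₁ η₂ 𝔞 := DoubleCoset.mk _ _ γ with hD
  obtain ⟨h, hh, δ, hδ, e⟩ := (DoubleCoset.eq _ _ (Quotient.out D : Γ) γ).1 (by
    rw [← hD]; exact Quotient.out_eq D)
  obtain ⟨t, ht⟩ := ha.exists_eq_translation hδ
  refine ⟨(D, t), ?_⟩
  refine Quotient.sound (QuotientGroup.rightRel_apply.2 ?_)
  have e' : γ * ((Quotient.out D : Γ) * ha.shift t)⁻¹ =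
      h * ((Quotient.out D : Γ) * (δ * (ha.shift t)⁻¹) * (Quotient.out D : Γ)⁻¹) := by
    rw [e]
    group
  simp only
  rw [e']
  -- The scaling determines `δ` only up to sign. This is harmless, since an element `±1` of `Γ` lies
  -- in `Γ_η`.
  have hδs : (δ : SL(2, ℝ)) = ha.shift t ∨ (δ : SL(2, ℝ)) = -ha.shift t := by
    have cancel {g g' : SL(2, ℝ)} (h : σa⁻¹ * g * σa = σa⁻¹ * g' * σa) : g = g' :=
      mul_left_cancel (mul_right_cancel h)
    have hneg : σa⁻¹ * (-(ha.shift t : SL(2, ℝ))) * σa =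
        -(σa⁻¹ * (ha.shift t : SL(2, ℝ)) * σa) := by rw [mul_neg, neg_mul]
    rcases ht with h1 | h1 <;> rcases ha.conj_shift t with h2 | h2
    · exact Or.inl (cancel (h1.trans h2.symm))
    · exact Or.inr (cancel (by rw [hneg, h1, h2, neg_neg]))
    · exact Or.inr (cancel (by rw [hneg, h1, h2]))
    · exact Or.inl (cancel (h1.trans h2.symm))
  have hone : (((Quotient.out D : Γ) * (δ * (ha.shift t)⁻¹) * (Quotient.out D : Γ)⁻¹ : Γ) :
      SL(2, ℝ)) = 1 ∨ (((Quotient.out D : Γ) * (δ * (ha.shift t)⁻¹) * (Quotient.out D : Γ)⁻¹ : Γ) :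
      SL(2, ℝ)) = -1 := by
    simp only [Subgroup.coe_mul, Subgroup.coe_inv]
    rcases hδs with h | h
    · left
      rw [h]
      group
    · right
      rw [h, neg_mul, mul_inv_cancel, mul_neg, mul_one, neg_mul, mul_inv_cancel]
  exact mul_mem hh ⟨mem_cuspStab_of_eq_one_or hone η₁, mem_cuspStab_of_eq_one_or hone η₂⟩

/-- Equal cosets give `M T^t' = ± diag(eˢ, e⁻ˢ) M T^t`. As `a ≠ 0`, the upper left entry forces `±
eˢ = 1`, and then the upper right one forces `t = t'`. -/
lemma cosetOfShift_injective [DiscreteTopology Γ] (hη : IsHyperbolicScaling Γ η₁ η₂ ση ℓ)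
    (ha : IsCuspScaling Γ 𝔞 σa) :
    Function.Injective (cosetOfShift (η₁ := η₁) (η₂ := η₂) ha) := by
  rintro ⟨D, t⟩ ⟨D', t'⟩ h
  have hmem := QuotientGroup.rightRel_apply.1 (Quotient.exact h)
  simp only at hmem
  obtain ⟨g, hg⟩ : ∃ g, g = (Quotient.out D' : Γ) * ha.shift t' *
    ((Quotient.out D : Γ) * ha.shift t)⁻¹ := ⟨_, rfl⟩
  rw [← hg] at hmem
  have hD : D = D' := by
    rw [← DoubleCoset.out_eq' _ _ D, ← DoubleCoset.out_eq' _ _ D', DoubleCoset.eq]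
    refine ⟨g, hmem, ha.shift t * (ha.shift t')⁻¹,
      mul_mem (ha.shift_mem t) (inv_mem (ha.shift_mem t')), ?_⟩
    rw [hg]
    group
  subst hD
  obtain ⟨s, hs⟩ := hη.exists_eq_dilation hmem
  have e : g * ((Quotient.out D : Γ) * ha.shift t) = (Quotient.out D : Γ) * ha.shift t' := by
    rw [hg]
    group
  have e' := congrArg (fun γ : Γ => ση⁻¹ * (γ : SL(2, ℝ)) * σa) e
  simp only [Subgroup.coe_mul] at e'
  obtain ⟨M, hM⟩ : ∃ M, M = ση⁻¹ * ((Quotient.out D : Γ) : SL(2, ℝ)) * σa := ⟨_, rfl⟩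
  have hM0 : M 0 0 ≠ 0 := hM ▸ left_ne_zero_of_scaling hη ha _
  have h1 := conj_mul_eq_or (τ := σa)
    (γ := ((Quotient.out D : Γ) : SL(2, ℝ)) * (ha.shift t : SL(2, ℝ))) hs
  have h2 := mul_conj_eq_or (σ := ση) (γ := ((Quotient.out D : Γ) : SL(2, ℝ))) (ha.conj_shift t)
  have h3 := mul_conj_eq_or (σ := ση) (γ := ((Quotient.out D : Γ) : SL(2, ℝ))) (ha.conj_shift t')
  rw [e'] at h1
  rw [← hM] at h2 h3
  have h4 : M * translation t' = dilation (s * ℓ / 2) * (M * translation t) ∨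
      M * translation t' = -(dilation (s * ℓ / 2) * (M * translation t)) := by
    rcases h1 with h1 | h1 <;> rcases h2 with h2 | h2 <;> rcases h3 with h3 | h3 <;>
      rw [h2, h3] at h1 <;> try simp only [mul_neg, neg_neg, neg_eq_iff_eq_neg] at h1
    all_goals first
      | exact Or.inl h1
      | exact Or.inr h1
  have key : ∀ x : ℝ, M 0 0 = x * M 0 0 → M 0 1 + t' * M 0 0 = x * (M 0 1 + t * M 0 0) →
      t = t' := by
    intro x h5 h6
    have hx : x = 1 := by
      have : (x - 1) * M 0 0 = 0 := by linarith
      rcases mul_eq_zero.1 this with h | h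
      · linarith
      · exact absurd h hM0
    rw [hx, one_mul] at h6
    have : (t : ℝ) = t' := mul_right_cancel₀ hM0 (by linarith)
    exact_mod_cast this
  have ht : t = t' := by
    rcases h4 with h4 | h4
    · have h5 := congrArg (fun g : SL(2, ℝ) => g 0 0) h4
      have h6 := congrArg (fun g : SL(2, ℝ) => g 0 1) h4
      simp only [coe_dilation_mul, coe_mul_translation, Matrix.of_apply, Matrix.cons_val',
        Matrix.cons_val_zero, Matrix.cons_val_one, Matrix.cons_val_fin_one] at h5 h6
      exact key _ h5 h6
    · have h5 := congrArg (fun g : SL(2, ℝ) => g 0 0) h4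
      have h6 := congrArg (fun g : SL(2, ℝ) => g 0 1) h4
      simp only [Matrix.SpecialLinearGroup.coe_neg, Matrix.neg_apply, coe_dilation_mul,
        coe_mul_translation, Matrix.of_apply, Matrix.cons_val', Matrix.cons_val_zero,
        Matrix.cons_val_one, Matrix.cons_val_fin_one] at h5 h6
      rw [← neg_mul] at h5 h6
      exact key _ h5 h6
  rw [ht]

end Stabilizers

/-! ### Unfolding the Poincaré series -/

section PoincareSeries

variable {Γ : Subgroup SL(2, ℝ)} {η₁ η₂ 𝔞 : OnePoint ℝ} {ση σa : SL(2, ℝ)} {ℓ : ℝ}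

lemma hypPoincareTerm_eq (k : ℕ) (m : ℤ) (γ : SL(2, ℝ)) (z : ℍ) :
    hypPoincareTerm k ση ℓ m γ z = hypSlash k ℓ m (ση⁻¹ * γ) z := rfl

lemma summable_norm_hypSlash [DiscreteTopology Γ] (hη : IsHyperbolicScaling Γ η₁ η₂ ση ℓ)
    {k : ℕ} (hk : Even k) (hk4 : 4 ≤ k) (m : ℤ) (τ : SL(2, ℝ)) (z : ℍ) :
    Summable fun q : PairCosets Γ η₁ η₂ =>
      ‖hypSlash k ℓ m (ση⁻¹ * (q.out : Γ) * τ) z‖ := by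
  obtain ⟨j, rfl⟩ := hk
  exact Summable.of_nonneg_of_le (fun _ => norm_nonneg _)
    (fun q => norm_hypSlash_le (by omega) ℓ m _ z) ((summable_inv_rowNormProd hη τ).mul_left _)

lemma hypPoincare_slash (Γ : Subgroup SL(2, ℝ)) (η₁ η₂ : OnePoint ℝ) (ση : SL(2, ℝ)) (ℓ : ℝ)
    (k : ℕ) (m : ℤ) (σ : SL(2, ℝ)) (z : ℍ) :
    (hypPoincare Γ k η₁ η₂ ση ℓ m ∣[(k : ℤ)] glOf σ) z =
      ∑' q : PairCosets Γ η₁ η₂, hypSlash k ℓ m (ση⁻¹ * (q.out : Γ) * σ) z := by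
  rw [slash_glOf_apply, hypPoincare, ← tsum_mul_right]
  refine tsum_congr fun q => ?_
  rw [hypPoincareTerm_eq, ← slash_glOf_apply k (hypSlash k ℓ m (ση⁻¹ * (q.out : Γ))),
    hypSlash_slash]

/-- The bijection between `(Γ_η \ Γ / Γ_𝔞) × ℤ` and `Γ_η \ Γ`. -/
def shiftEquiv [DiscreteTopology Γ] (hη : IsHyperbolicScaling Γ η₁ η₂ ση ℓ)
    (ha : IsCuspScaling Γ 𝔞 σa) : PairCuspCosets Γ η₁ η₂ 𝔞 × ℤ ≃ PairCosets Γ η₁ η₂ :=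
  Equiv.ofBijective (cosetOfShift ha) ⟨cosetOfShift_injective hη ha, cosetOfShift_surjective ha⟩

/-- General in `F` because it transports both the terms `hypSlash` and their majorants `rowNormProd`
along the bijection. -/
lemma apply_shiftEquiv [DiscreteTopology Γ] {α : Type*} (hη : IsHyperbolicScaling Γ η₁ η₂ ση ℓ)
    (ha : IsCuspScaling Γ 𝔞 σa) {F : SL(2, ℝ) → α} (hneg : ∀ M, F (-M) = F M)
    (hdil : ∀ (t : ℤ) M, F (dilation (t * ℓ / 2) * M) = F M)
    (p : PairCuspCosets Γ η₁ η₂ 𝔞 × ℤ) :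
    F (ση⁻¹ * ((shiftEquiv hη ha p).out : Γ) * σa) =
      F (repMatrix ση σa p.1 * translation p.2) := by
  have hq := hη.apply_eq_of_mk_eq hneg hdil σa (γ := (shiftEquiv hη ha p).out)
    (γ' := (Quotient.out p.1 : Γ) * ha.shift p.2) (Quotient.out_eq (shiftEquiv hη ha p))
  rw [hq, Subgroup.coe_mul]
  rcases mul_conj_eq_or (σ := ση) (γ := ((Quotient.out p.1 : Γ) : SL(2, ℝ)))
    (ha.conj_shift p.2) with h | h
  · rw [h, repMatrix]
  · rw [h, hneg, repMatrix]

/-- The translation makes `|b| ≤ |a|`; then `ad = 1 + bc` bounds `a²d²` by `2 + 2(ac)²`, so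
everything is controlled by `ac`. -/
lemma rowNormProd_mul_translation_le (M : SL(2, ℝ)) (hM : M 0 0 ≠ 0) :
    rowNormProd (M * translation (-⌊M 0 1 / M 0 0⌋ : ℤ)) ≤ 6 * (M 0 0 * M 1 0) ^ 2 + 4 := by
  have hdet := SL2_det_eq_one M
  set t : ℤ := -⌊M 0 1 / M 0 0⌋ with ht
  have hu : (M 0 1 + t * M 0 0) ^ 2 ≤ M 0 0 ^ 2 := by
    have h1 : |M 0 1 / M 0 0 + t| ≤ 1 := by
      have h1 := Int.floor_le (M 0 1 / M 0 0)
      have h2 := Int.lt_floor_add_one (M 0 1 / M 0 0)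
      rw [ht, abs_le]
      push_cast
      constructor <;> linarith
    have h2 : (M 0 1 / M 0 0 + t) ^ 2 ≤ 1 := (sq_le_one_iff_abs_le_one _).2 h1
    have h3 : M 0 1 + t * M 0 0 = (M 0 1 / M 0 0 + t) * M 0 0 := by field_simp
    rw [h3, mul_pow]
    exact mul_le_of_le_one_left (sq_nonneg _) h2
  rw [rowNormProd, coe_mul_translation]
  simp only [Matrix.of_apply, Matrix.cons_val', Matrix.cons_val_zero, Matrix.cons_val_one,
    Matrix.cons_val_fin_one]
  set u := M 0 1 + t * M 0 0 with hudef
  have h1 : M 0 0 * (M 1 1 + t * M 1 0) = 1 + M 1 0 * u := by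
    rw [hudef]
    linear_combination hdet
  have h2 : M 0 0 ^ 2 * (M 1 0 ^ 2 + (M 1 1 + t * M 1 0) ^ 2) ≤ 3 * (M 0 0 * M 1 0) ^ 2 + 2 := by
    have h3 : M 0 0 ^ 2 * (M 1 1 + t * M 1 0) ^ 2 = (1 + M 1 0 * u) ^ 2 := by rw [← h1]; ring
    nlinarith [sq_nonneg (1 - M 1 0 * u), mul_le_mul_of_nonneg_left hu (sq_nonneg (M 1 0))]
  calc _ ≤ (M 0 0 ^ 2 + M 0 0 ^ 2) * (M 1 0 ^ 2 + (M 1 1 + t * M 1 0) ^ 2) := by gcongr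
    _ ≤ _ := by linarith

/-- Double cosets with `ac = C` inject into cosets whose row product is at most `6C² + 4`; a
summable family has finitely many terms above a positive threshold. -/
lemma finite_cosetsWithModulus [DiscreteTopology Γ] (hη : IsHyperbolicScaling Γ η₁ η₂ ση ℓ)
    (ha : IsCuspScaling Γ 𝔞 σa) (C : ℝ) :
    (cosetsWithModulus Γ η₁ η₂ 𝔞 ση σa C).Finite := by
  set f : PairCuspCosets Γ η₁ η₂ 𝔞 → PairCosets Γ η₁ η₂ := fun D =>
    shiftEquiv hη ha (D, -⌊repMatrix ση σa D 0 1 / repMatrix ση σa D 0 0⌋) with hf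
  have hinj : Function.Injective f := fun D D' h =>
    congrArg Prod.fst ((shiftEquiv hη ha).injective h)
  have hs := (summable_inv_rowNormProd hη σa).comp_injective hinj
  have hev := hs.tendsto_cofinite_zero.eventually_lt_const
    (show (0 : ℝ) < (6 * C ^ 2 + 4)⁻¹ by positivity)
  refine (Filter.eventually_cofinite.1 hev).subset fun D hD => ?_
  have hD : repMatrix ση σa D 0 0 * repMatrix ση σa D 1 0 = C := hD
  rw [Set.mem_ofPred_eq, not_lt]
  simp only [Function.comp_apply, hf]
  rw [apply_shiftEquiv hη ha rowNormProd_neg (fun _ _ => rowNormProd_dilation_mul _ _)]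
  have h1 := rowNormProd_mul_translation_le (repMatrix ση σa D)
    (left_ne_zero_of_scaling hη ha (Quotient.out D))
  rw [hD] at h1
  exact inv_anti₀ (zero_lt_one.trans_le (one_le_rowNormProd _)) h1

/-- The contribution of a double coset to the `n`-th Fourier coefficient of the Poincaré
series. -/
def doubleCosetCoeff (k : ℕ) (ℓ : ℝ) (m : ℤ) (M : SL(2, ℝ)) (n : ℕ) : ℂ :=
  Complex.exp (2 * Real.pi * Complex.I *
      ((m : ℂ) / ℓ * Complex.log ((M 0 0 / M 1 0 : ℝ) : ℂ))) /
      ((M 0 0 * M 1 0 : ℝ) : ℂ) ^ (k / 2) *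
    (doublePoleCoeff k (hypBeta k ℓ m) (M 0 0 * M 1 0)⁻¹ n *
      Complex.exp (2 * Real.pi * Complex.I * (n : ℤ) * ((M 0 1 / M 0 0 : ℝ) : ℂ)))

lemma hasSum_doubleCosetCoeff {k : ℕ} (hk : Even k) (hk4 : 4 ≤ k) (ℓ : ℝ) (m : ℤ) (M : SL(2, ℝ))
    (ha : M 0 0 ≠ 0) (hc : M 1 0 ≠ 0) (z : ℍ) :
    HasSum (fun n : ℕ => doubleCosetCoeff k ℓ m M n *
      Complex.exp (2 * Real.pi * Complex.I * (n : ℤ) * (z : ℂ)))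
      (∑' t : ℤ, hypSlash k ℓ m (M * translation t) z) := by
  have hterm : ∀ t : ℤ, hypSlash k ℓ m (M * translation t) z =
      Complex.exp (2 * Real.pi * Complex.I *
        ((m : ℂ) / ℓ * Complex.log ((M 0 0 / M 1 0 : ℝ) : ℂ))) /
        ((M 0 0 * M 1 0 : ℝ) : ℂ) ^ (k / 2) *
      doublePole k (hypBeta k ℓ m) (M 0 0 * M 1 0)⁻¹
        (((M 0 1 / M 0 0 : ℝ) +ᵥ z : ℍ) + (t : ℂ)) := by
    intro t
    rw [hypSlash_mul_translation k ℓ m M t (w := (t : ℝ) +ᵥ z)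
      (by rw [UpperHalfPlane.coe_vadd, add_comm]), hypSlash_eq_doublePole hk ℓ m M ha hc]
    congr 2
    rw [UpperHalfPlane.coe_vadd, UpperHalfPlane.coe_vadd]
    push_cast
    ring
  simp_rw [hterm]
  rw [tsum_mul_left]
  have h := hasSum_periodizedDoublePole (by omega : 2 ≤ k) (hypBeta k ℓ m) (M 0 0 * M 1 0)⁻¹
    ((M 0 1 / M 0 0 : ℝ) +ᵥ z)
  refine (h.mul_left _).congr_fun fun n => ?_
  have he : Complex.exp (2 * Real.pi * Complex.I * (n : ℤ) * (((M 0 1 / M 0 0 : ℝ) +ᵥ z : ℍ) : ℂ)) =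
      Complex.exp (2 * Real.pi * Complex.I * (n : ℤ) * ((M 0 1 / M 0 0 : ℝ) : ℂ)) *
        Complex.exp (2 * Real.pi * Complex.I * (n : ℤ) * (z : ℂ)) := by
    rw [UpperHalfPlane.coe_vadd, mul_add, Complex.exp_add]
  rw [doubleCosetCoeff, he]
  ring

lemma hasSum_hypPoincare_slash [DiscreteTopology Γ] (hη : IsHyperbolicScaling Γ η₁ η₂ ση ℓ)
    (ha : IsCuspScaling Γ 𝔞 σa) {k : ℕ} (hk : Even k) (hk4 : 4 ≤ k) (m : ℤ) :
    (∀ n, Summable fun D : PairCuspCosets Γ η₁ η₂ 𝔞 =>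
      doubleCosetCoeff k ℓ m (repMatrix ση σa D) n) ∧
    ∀ z : ℍ, HasSum (fun n : ℕ => (∑' D : PairCuspCosets Γ η₁ η₂ 𝔞,
        doubleCosetCoeff k ℓ m (repMatrix ση σa D) n) *
          Complex.exp (2 * Real.pi * Complex.I * (n : ℤ) * (z : ℂ)))
      ((hypPoincare Γ k η₁ η₂ ση ℓ m ∣[(k : ℤ)] glOf σa) z) := by
  have happ := fun (p : PairCuspCosets Γ η₁ η₂ 𝔞 × ℤ) => apply_shiftEquiv hη ha
    (F := hypSlash k ℓ m) (hypSlash_neg hk ℓ m) (hypSlash_dilation_mul k hη.length_pos m) p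
  have hrow := (shiftEquiv hη ha).summable_iff.2 (summable_inv_rowNormProd hη σa)
  have key := hasSum_exp_tsum (f := fun (D : PairCuspCosets Γ η₁ η₂ 𝔞) z =>
      ∑' t : ℤ, hypSlash k ℓ m (repMatrix ση σa D * translation t) z)
    (fun D z => hasSum_doubleCosetCoeff hk hk4 ℓ m (repMatrix ση σa D)
      (left_ne_zero_of_scaling hη ha _) (right_ne_zero_of_scaling hη ha _) z) ?_
  · refine ⟨key.1, fun z => ?_⟩
    convert key.2 z using 1
    rw [hypPoincare_slash, ← (shiftEquiv hη ha).tsum_eq]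
    have hs := (shiftEquiv hη ha).summable_iff.2 (summable_norm_hypSlash hη hk hk4 m σa z).of_norm
    refine (Summable.tsum_prod hs).trans ?_
    exact tsum_congr fun D => tsum_congr fun t => congrFun (happ (D, t)) z
  · intro y hy
    obtain ⟨j, rfl⟩ := hk
    refine ⟨_, (hrow.mul_left (Real.exp (Real.pi * |2 * Real.pi * m / ℓ|) *
      ((y ^ 2 / (y ^ 2 + 2)) ^ j)⁻¹)).prod, fun D z hzy hzx => ?_⟩
    refine tsum_of_norm_bounded ((hrow.mul_left _).prod_factor D).hasSum fun t => ?_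
    rw [← congrFun (happ (D, t)) z]
    refine (norm_hypSlash_le (by omega) ℓ m _ z).trans ?_
    -- On the segment of height `y` over `[0, 1]`, `|z|² + 1 ≤ y² + 2`, which makes the majorant
    -- uniform in `z`.
    have hle : y ^ 2 / (y ^ 2 + 2) ≤ minRatio z := by
      rw [minRatio, UpperHalfPlane.coe_im, hzy, Complex.sq_norm, Complex.normSq_apply,
        UpperHalfPlane.coe_im, UpperHalfPlane.coe_re, hzy]
      exact div_le_div_of_nonneg_left (by positivity)
        (by nlinarith [mul_self_nonneg z.re, mul_self_nonneg y]) (by nlinarith [hzx.1, hzx.2])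
    have h1 := one_le_rowNormProd (ση⁻¹ * ((shiftEquiv hη ha (D, t)).out : Γ) * σa)
    simp only [Function.comp_apply]
    gcongr

lemma hasSum_exp_int_of_nat {a : ℕ → ℂ} {z S : ℂ}
    (h : HasSum (fun n : ℕ => a n * Complex.exp (2 * Real.pi * Complex.I * (n : ℤ) * z)) S) :
    HasSum (fun n : ℤ => (if 0 ≤ n then a n.toNat else 0) *
      Complex.exp (2 * Real.pi * Complex.I * n * z)) S := by
  rw [← Function.Injective.hasSum_iff (g := fun n : ℕ => (n : ℤ)) Nat.cast_injective]
  · simpa [Function.comp_def] using h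
  · intro n hn
    have : ¬ 0 ≤ n := fun h0 => hn ⟨n.toNat, Int.toNat_of_nonneg h0⟩
    simp [this]

/-- Coefficients are integrals over a segment of height `1`. Thus any given expansion is the one
obtained by unfolding. -/
lemma HasParabolicExpansion.unique {k : ℕ} {σ : SL(2, ℝ)} {f : ℍ → ℂ} {c c' : ℤ → ℂ}
    (h : HasParabolicExpansion k σ f c) (h' : HasParabolicExpansion k σ f c') : c = c' := by
  funext n
  let p : ℝ → ℍ := fun u => ⟨u + (1 : ℝ) * Complex.I, by simp⟩
  exact (integral_exp_mul_eq_of_hasSum (ν := id) Function.injective_id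
    (g := fun u => (f ∣[(k : ℤ)] glOf σ) (p u)) (fun u => h (p u)) n).symm.trans
    (integral_exp_mul_eq_of_hasSum (ν := id) Function.injective_id (fun u => h' (p u)) n)

/-- The summand of `starKloosterman`. -/
def kloostermanTerm (ℓ : ℝ) (m n : ℤ) (M : SL(2, ℝ)) : ℂ :=
  Complex.exp (2 * Real.pi * Complex.I *
    ((m : ℂ) / ℓ * Complex.log ((M 0 0 / M 1 0 : ℝ) : ℂ) + n * ((M 0 1 / M 0 0 : ℝ) : ℂ)))

lemma doubleCosetCoeff_eq {k : ℕ} (hk : Even k) (ℓ : ℝ) (m : ℤ) (M : SL(2, ℝ)) (n : ℕ) :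
    doubleCosetCoeff k ℓ m M n =
      (2 * Real.pi * Complex.I) ^ k * (n : ℂ) ^ (k - 1) / Complex.Gamma k *
      (oneFOne (hypBeta k ℓ m) k (2 * Real.pi * Complex.I * n / ((M 0 0 * M 1 0 : ℝ) : ℂ)) *
        (kloostermanTerm ℓ m n M / ((M 0 0 * M 1 0 : ℝ) : ℂ) ^ (k / 2))) := by
  have e1 : kloostermanTerm ℓ m n M = Complex.exp (2 * Real.pi * Complex.I *
      ((m : ℂ) / ℓ * Complex.log ((M 0 0 / M 1 0 : ℝ) : ℂ))) *
      Complex.exp (2 * Real.pi * Complex.I * (n : ℤ) * ((M 0 1 / M 0 0 : ℝ) : ℂ)) := by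
    rw [kloostermanTerm, ← Complex.exp_add]
    congr 1
    ring
  have e2 : (-2 * Real.pi * Complex.I) ^ k = (2 * Real.pi * Complex.I) ^ k := by
    rw [← hk.neg_pow]
    congr 1
    ring
  rw [doubleCosetCoeff, doublePoleCoeff, e1, e2, Complex.ofReal_inv, ← div_eq_mul_inv]
  ring

lemma hasSum_mul_finsum_fiber {ι : Type*} {C : ι → ℝ} {S : Set ℝ} (hC : ∀ i, C i ∈ S)
    (hfin : ∀ x, {i | C i = x}.Finite) {G : ℝ → ℂ} {K : ι → ℂ} {s : ℂ}
    (h : HasSum (fun i => G (C i) * K i) s) :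
    HasSum (fun x : S => G x * ∑ᶠ i ∈ {i | C i = x}, K i) s := by
  refine (h.tsum_fiberwise fun i => (⟨C i, hC i⟩ : S)).congr_fun fun x => ?_
  have hset : (fun i => (⟨C i, hC i⟩ : S)) ⁻¹' {x} = {i | C i = x} := by
    ext i
    exact Subtype.ext_iff
  have hterm : ∀ i : {i | C i = (x : ℝ)}, G (C i) * K i = G x * K i := fun i => by
    rw [show C i = x from i.2]
  have := (hfin x).to_subtype
  rw [hset, tsum_congr hterm, tsum_mul_left, tsum_eq_finsum (Set.toFinite _),
    finsum_set_coe_eq_finsum_mem (f := K)]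

lemma hasSum_fiberwise_modulus [DiscreteTopology Γ] (hη : IsHyperbolicScaling Γ η₁ η₂ ση ℓ)
    (ha : IsCuspScaling Γ 𝔞 σa) {k : ℕ} (m n : ℤ) (G : ℝ → ℂ) {S : ℂ}
    (h : HasSum (fun D : PairCuspCosets Γ η₁ η₂ 𝔞 =>
      G (repMatrix ση σa D 0 0 * repMatrix ση σa D 1 0) *
        (kloostermanTerm ℓ m n (repMatrix ση σa D) /
          ((repMatrix ση σa D 0 0 * repMatrix ση σa D 1 0 : ℝ) : ℂ) ^ (k / 2))) S) :
    HasSum (fun C : moduliSet Γ ση σa =>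
      G C * (starKloosterman Γ η₁ η₂ 𝔞 ση σa ℓ m n C / ((C : ℝ) : ℂ) ^ (k / 2))) S := by
  have hmem : ∀ D : PairCuspCosets Γ η₁ η₂ 𝔞,
      repMatrix ση σa D 0 0 * repMatrix ση σa D 1 0 ∈ moduliSet Γ ση σa :=
    fun D => ⟨(Quotient.out D : Γ), SetLike.coe_mem _, rfl⟩
  have key := hasSum_mul_finsum_fiber (G := fun C => G C / (C : ℂ) ^ (k / 2))
    (K := fun D => kloostermanTerm ℓ m n (repMatrix ση σa D)) hmem
    (finite_cosetsWithModulus hη ha) (h.congr_fun fun D => by ring)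
  refine key.congr_fun fun C => ?_
  rw [starKloosterman, mul_div_assoc', div_mul_eq_mul_div]
  rfl

lemma hasParabolicExpansion_hypPoincare [DiscreteTopology Γ]
    (hη : IsHyperbolicScaling Γ η₁ η₂ ση ℓ) (ha : IsCuspScaling Γ 𝔞 σa) {k : ℕ} (hk : Even k)
    (hk4 : 4 ≤ k) (m : ℤ) :
    HasParabolicExpansion k σa (hypPoincare Γ k η₁ η₂ ση ℓ m) fun n : ℤ =>
      if 0 ≤ n then ∑' D : PairCuspCosets Γ η₁ η₂ 𝔞,
        doubleCosetCoeff k ℓ m (repMatrix ση σa D) n.toNat else 0 :=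
  fun z => hasSum_exp_int_of_nat (a := fun n : ℕ => ∑' D : PairCuspCosets Γ η₁ η₂ 𝔞,
    doubleCosetCoeff k ℓ m (repMatrix ση σa D) n)
    ((hasSum_hypPoincare_slash hη ha hk hk4 m).2 z)

lemma coeffFactor_ne_zero {k n : ℕ} (hk : k ≠ 0) (hn : n ≠ 0) :
    (2 * Real.pi * Complex.I) ^ k * (n : ℂ) ^ (k - 1) / Complex.Gamma k ≠ 0 := by
  refine div_ne_zero (mul_ne_zero (pow_ne_zero _ Complex.two_pi_I_ne_zero)
    (pow_ne_zero _ (Nat.cast_ne_zero.2 hn))) (Complex.Gamma_ne_zero_of_re_pos ?_)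
  rw [Complex.natCast_re]
  exact_mod_cast Nat.pos_of_ne_zero hk

/-- Group the double cosets by `C = ac`. Removing the common prefactor from the convergent series
requires it to be non-zero, hence `n ≠ 0`. -/
lemma hasSum_oneFOne_mul_starKloosterman [DiscreteTopology Γ] (hη : IsHyperbolicScaling Γ η₁ η₂ ση ℓ)
    (ha : IsCuspScaling Γ 𝔞 σa) {k : ℕ} (hk : Even k) (hk4 : 4 ≤ k) (m : ℤ) {n : ℕ}
    (hn : n ≠ 0) :
    HasSum (fun C : moduliSet Γ ση σa =>
      oneFOne (hypBeta k ℓ m) k (2 * Real.pi * Complex.I * n / ((C : ℝ) : ℂ)) *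
        (starKloosterman Γ η₁ η₂ 𝔞 ση σa ℓ m n C / ((C : ℝ) : ℂ) ^ (k / 2)))
      (((2 * Real.pi * Complex.I) ^ k * (n : ℂ) ^ (k - 1) / Complex.Gamma k)⁻¹ *
        ∑' D : PairCuspCosets Γ η₁ η₂ 𝔞, doubleCosetCoeff k ℓ m (repMatrix ση σa D) n) := by
  have hpre := coeffFactor_ne_zero (k := k) (by omega) hn
  have hs := (((hasSum_hypPoincare_slash hη ha hk hk4 m).1 n).hasSum).mul_left
    ((2 * Real.pi * Complex.I) ^ k * (n : ℂ) ^ (k - 1) / Complex.Gamma k)⁻¹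
  refine hasSum_fiberwise_modulus hη ha m n
    (fun C => oneFOne (hypBeta k ℓ m) k (2 * Real.pi * Complex.I * n / (C : ℂ)))
    (hs.congr_fun fun D => ?_)
  rw [doubleCosetCoeff_eq hk, inv_mul_cancel_left₀ hpre]

end PoincareSeries

end

theorem theorem1p2 (Γ : Subgroup SL(2, ℝ)) (hΓ : IsFuchsianFirstKind Γ)
    (k : ℕ) (hk : Even k) (hk4 : 4 ≤ k)
    (η₁ η₂ 𝔞 : OnePoint ℝ) (hη : IsHyperbolicPair Γ η₁ η₂) (ha : IsCuspOf Γ 𝔞)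
    (ση σa : SL(2, ℝ)) (ℓ : ℝ)
    (hση : IsHyperbolicScaling Γ η₁ η₂ ση ℓ) (hσa : IsCuspScaling Γ 𝔞 σa) (m : ℤ) :
    -- the Poincaré series converges absolutely
    (∀ z : ℍ, Summable fun q : PairCosets Γ η₁ η₂ =>
      hypPoincareTerm k ση ℓ m (q.out : Γ) z) ∧
    -- the moduli are non-zero and the Kloosterman sums are finite sums
    (0 : ℝ) ∉ moduliSet Γ ση σa ∧
    (∀ C : ℝ, (cosetsWithModulus Γ η₁ η₂ 𝔞 ση σa C).Finite) ∧
    -- the Poincaré series has a parabolic Fourier expansion at `𝔞`, and its coefficients of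
    -- positive index are given by the absolutely convergent formula
    (∃ c : ℤ → ℂ, HasParabolicExpansion k σa (hypPoincare Γ k η₁ η₂ ση ℓ m) c) ∧
    ∀ c : ℤ → ℂ, HasParabolicExpansion k σa (hypPoincare Γ k η₁ η₂ ση ℓ m) c →
      ∀ n : ℤ, 1 ≤ n →
        (Summable fun C : moduliSet Γ ση σa =>
          oneFOne ((k : ℂ) / 2 + 2 * Real.pi * Complex.I * m / ℓ) k
              (2 * Real.pi * Complex.I * n / ((C : ℝ) : ℂ)) *
            (starKloosterman Γ η₁ η₂ 𝔞 ση σa ℓ m n C / ((C : ℝ) : ℂ) ^ (k / 2))) ∧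
        c n = (2 * Real.pi * Complex.I) ^ k * (n : ℂ) ^ (k - 1) / Complex.Gamma k *
          ∑' C : moduliSet Γ ση σa,
            oneFOne ((k : ℂ) / 2 + 2 * Real.pi * Complex.I * m / ℓ) k
                (2 * Real.pi * Complex.I * n / ((C : ℝ) : ℂ)) *
              (starKloosterman Γ η₁ η₂ 𝔞 ση σa ℓ m n C / ((C : ℝ) : ℂ) ^ (k / 2)) := by
  have := hΓ.discrete
  have hc₀ := hasParabolicExpansion_hypPoincare hση hσa hk hk4 m
  refine ⟨fun z => ?_, ?_, finite_cosetsWithModulus hση hσa, ⟨_, hc₀⟩, fun c hc n hn => ?_⟩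
  · simpa [hypPoincareTerm_eq] using (summable_norm_hypSlash hση hk hk4 m 1 z).of_norm
  · rintro ⟨γ, hγ, h⟩
    exact mul_ne_zero_of_scaling hση hσa ⟨γ, hγ⟩ h
  · obtain ⟨n, rfl⟩ : ∃ n' : ℕ, n = n' := ⟨n.toNat, by omega⟩
    have hn0 : n ≠ 0 := by omega
    have hpre := coeffFactor_ne_zero (k := k) (by omega) hn0
    have key := hasSum_oneFOne_mul_starKloosterman hση hσa hk hk4 m hn0
    have hcn : c n = ∑' D : PairCuspCosets Γ η₁ η₂ 𝔞,
        doubleCosetCoeff k ℓ m (repMatrix ση σa D) n := by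
      simp only [hc.unique hc₀, if_pos (Int.natCast_nonneg n), Int.toNat_natCast]
    rw [hypBeta] at key
    rw [Int.cast_natCast]
    refine ⟨key.summable, ?_⟩
    rw [key.tsum_eq, hcn, mul_inv_cancel_left₀ hpre]
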